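/- Consider a sequence of models in which $T\to\infty$; $n$, $d$, $\mathbf{Z}^\star$, $\mathbf{N}$, $\nu_i$ and all quantities built from them may vary along the sequence. Let $\mathbf{Z}^\star\in\mathbb{R}^{n\times T}$ be deterministic and let $\mathbf{Z}=\mathbf{Z}^\star+\mathbf{N}$ be the observation. For a matrix $\mathbf{Y}\in\mathbb{R}^{n\times T}$ write $\bar Y_i=\frac1T\sum_{t}Y_{i,t}$, $\sigma_i^2(\mathbf{Y})=\frac1T\sum_{t}(Y_{i,t}-\bar Y_i)^2$, and let $\operatorname{Corr}(\mathbf{Y})\in\mathbb{R}^{n\times n}$ be the correlation matrix of its rows, with entries $\frac1T\sum_t (Y_{i,t}-\bar Y_i)(Y_{j,t}-\bar Y_j)/(\sigma_i(\mathbf{Y})\,\sigma_j(\mathbf{Y}))$. Put $\mathbf{R}^\star=\operatorname{Corr}(\mathbf{Z}^\star)$ and $\mathbf{R}=\operatorname{Corr}(\mathbf{Z})$, and assume $\sigma_i^2(\mathbf{Z}^\star)>0$ for all $i$. Write $\mathbf{R}^\star=\mathbf{U}^\star\mathbf{\Lambda}^\star\mathbf{U}^{\star\top}$, where $\mathbf{\Lambda}^\star=\operatorname{diag}(\lambda_1,\dots,\lambda_d)$,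 $d\ge1$, contains all the non-zero eigenvalues $\lambda_1\ge\dots\ge\lambda_d>0$ of $\mathbf{R}^\star$ and $\mathbf{U}^\star\in\mathbb{R}^{n\times d}$ has corresponding orthonormal eigenvectors as columns. Let $\mathbf{X}^\star=\mathbf{U}^\star\mathbf{\Lambda}^{\star1/2}$, $\kappa=\lambda_1/\lambda_d$ and $\gamma=\min_{i}\sigma_i^2(\mathbf{Z}^\star)/\nu_i$, where $\nu_i>0$. Let $\|\cdot\|_{2,\infty}$ be the maximum Euclidean norm of the rows of a matrix and $\mathbb{O}_d$ the group of $d\times d$ orthogonal matrices. The adjacency spectral embedding $\operatorname{ASE}(\mathbf{A},d)=\mathbf{V}|\mathbf{D}|^{1/2}$ of a symmetric matrix $\mathbf{A}$ is formed from its $d$ largest-magnitude eigenvalues (the diagonal of $\mathbf{D}$) and corresponding orthonormal eigenvectors (the columns of $\mathbf{V}$). Assume that the rows $\mathbf{N}_1,\dots,\mathbf{N}_n$ of $\mathbf{N}$ are independent and mean-zero and that $\mathbf{N}_i$ is $\nu_i$-subgaussian, i.e. $\mathbb{E}\exp(s\,\mathbf{u}^\top\mathbf{N}_i)\le\exp(\nu_i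 s^2/2)$ for all $s\in\mathbb{R}$ and all unit vectors $\mathbf{u}\in\mathbb{R}^T$. Let $C_0\in\mathbb{R}$ and $c_0>0$ be constants, and assume that, for all sufficiently large indices of the sequence, $n\le C_0T$ and $\lambda_d\ge c_0$, and that $\kappa=o(T)$ and $\kappa\log T/\gamma=o(1)$. Then there is a constant $C>0$ depending only on $C_0$ and $c_0$ such that, for all sufficiently large indices, with probability at least $1-CT^{-2}$, every version $\hat{\mathbf{X}}$ of $\operatorname{ASE}(\mathbf{R},d)$ (i.e. for every choice of the eigenvectors) satisfies $$\min_{\mathbf{Q}\in\mathbb{O}_d}\|\hat{\mathbf{X}}-\mathbf{X}^\star\mathbf{Q}\|_{2,\infty}\le C\sqrt{\frac{d\log T}{\gamma\lambda_d}}\left[1+\kappa\left(\kappa\sqrt{\frac{\log n}{\gamma}}+\sqrt{\frac1T}\right)\|\mathbf{R}^\star\|_{2,\infty}\right].$$ -/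

import Mathlib

open MeasureTheory ProbabilityTheory Filter Topology
open scoped NNReal ENNReal Matrix

noncomputable section

namespace CorrNet

/-- Time average of a series of length `T`. -/
def timeMean {T : ℕ} (z : Fin T → ℝ) : ℝ := (1 / (T : ℝ)) * ∑ t, z t

/-- Sample covariance (normalized by `1 / T`) of two series of length `T`. -/
def sampleCov {T : ℕ} (z w : Fin T → ℝ) : ℝ :=
  (1 / (T : ℝ)) * ∑ t, (z t - timeMean z) * (w t - timeMean w)

/-- Power `σ²` of a series of length `T` about its time average. -/
def sampleVar {T : ℕ} (z : Fin T → ℝ) : ℝ :=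
  (1 / (T : ℝ)) * ∑ t, (z t - timeMean z) ^ 2

/-- Correlation matrix of the rows of `Z`. -/
def corrMatrix {n T : ℕ} (Z : Matrix (Fin n) (Fin T) ℝ) : Matrix (Fin n) (Fin n) ℝ :=
  Matrix.of fun i j =>
    sampleCov (Z i) (Z j) / (Real.sqrt (sampleVar (Z i)) * Real.sqrt (sampleVar (Z j)))

theorem corrMatrix_isHermitian {n T : ℕ} (Z : Matrix (Fin n) (Fin T) ℝ) :
    (corrMatrix Z).IsHermitian := by
  ext i j
  simp [corrMatrix, sampleCov, mul_comm]

/-- The `(2,∞)`-norm: the maximum Euclidean norm of the rows. -/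
def twoInfNorm {n p : ℕ} (B : Matrix (Fin n) (Fin p) ℝ) : ℝ :=
  ⨆ i, Real.sqrt (∑ k, B i k ^ 2)

/-- Signal-to-noise ratio `γ = min_i σ_i² / ν_i`. -/
def snr {n T : ℕ} (Z : Matrix (Fin n) (Fin T) ℝ) (ν : Fin n → ℝ≥0) : ℝ :=
  ⨅ i, sampleVar (Z i) / (ν i : ℝ)

/-- `A = U diag(lam) Uᵀ`, where `lam` lists the non-zero eigenvalues of the positive semidefinite
matrix `A` in non-increasing order (with multiplicity) and the columns of `U` are corresponding
orthonormal eigenvectors. -/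
structure IsReducedSpectral {n d : ℕ} (A : Matrix (Fin n) (Fin n) ℝ)
    (U : Matrix (Fin n) (Fin d) ℝ) (lam : Fin d → ℝ) : Prop where
  orthonormal : Uᵀ * U = 1
  antitone : Antitone lam
  pos : ∀ k, 0 < lam k
  decomp : A = U * Matrix.diagonal lam * Uᵀ

/-- The first (largest) entry `λ₁` of a list of `d ≥ 1` eigenvalues. -/
def firstEig {d : ℕ} (hd : 0 < d) (lam : Fin d → ℝ) : ℝ := lam ⟨0, hd⟩

/-- The last (smallest) entry `λ_d` of a list of `d ≥ 1` eigenvalues. -/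
def lastEig {d : ℕ} (hd : 0 < d) (lam : Fin d → ℝ) : ℝ :=
  lam ⟨d - 1, Nat.sub_lt hd Nat.one_pos⟩

/-- Condition number `κ = λ₁ / λ_d`. -/
def condNumber {d : ℕ} (hd : 0 < d) (lam : Fin d → ℝ) : ℝ := firstEig hd lam / lastEig hd lam

/-- The embedding `U diag(lam)^{1/2}`. -/
def embedding {n d : ℕ} (U : Matrix (Fin n) (Fin d) ℝ) (lam : Fin d → ℝ) :
    Matrix (Fin n) (Fin d) ℝ :=
  U * Matrix.diagonal fun k => Real.sqrt (lam k)

/-- `X` is a `d`-dimensional adjacency spectral embedding `V |D|^{1/2}` of `A`: for some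
orthonormal eigenbasis (columns of `W`) with eigenvalues `θ` sorted by non-increasing magnitude,
`V` consists of the first `d` columns of `W` and `D` of the first `d` entries of `θ`. (The
embedding is determined by `A` only up to the choice of this eigenbasis.) -/
def IsASE {n d : ℕ} (A : Matrix (Fin n) (Fin n) ℝ) (X : Matrix (Fin n) (Fin d) ℝ) : Prop :=
  ∃ (hdn : d ≤ n) (W : Matrix (Fin n) (Fin n) ℝ) (θ : Fin n → ℝ),
    Wᵀ * W = 1 ∧ A = W * Matrix.diagonal θ * Wᵀ ∧ Antitone (fun j => |θ j|) ∧
      X = Matrix.of fun i k => W i (Fin.castLE hdn k) * Real.sqrt |θ (Fin.castLE hdn k)|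

/-- Every real symmetric matrix has an adjacency spectral embedding of each dimension `d ≤ n`. -/
theorem exists_isASE {n d : ℕ} (hdn : d ≤ n) (A : Matrix (Fin n) (Fin n) ℝ) (hA : A.IsHermitian) :
    ∃ X : Matrix (Fin n) (Fin d) ℝ, IsASE A X := by
  let V : Matrix (Fin n) (Fin n) ℝ := hA.eigenvectorUnitary
  have hV : Vᵀ * V = 1 := by
    have := Unitary.coe_star_mul_self hA.eigenvectorUnitary
    rwa [Matrix.star_eq_conjTranspose, Matrix.conjTranspose_eq_transpose_of_trivial] at this
  have hD : A = V * Matrix.diagonal hA.eigenvalues * Vᵀ := by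
    have := hA.spectral_theorem
    rw [Unitary.conjStarAlgAut_apply, Matrix.star_eq_conjTranspose,
      Matrix.conjTranspose_eq_transpose_of_trivial] at this
    exact this
  let s : Equiv.Perm (Fin n) := Tuple.sort fun j => -|hA.eigenvalues j|
  have hs : Monotone ((fun j => -|hA.eigenvalues j|) ∘ s) := Tuple.monotone_sort _
  refine ⟨_, hdn, V.submatrix id s, hA.eigenvalues ∘ s, ?_, ?_, ?_, rfl⟩
  · ext i j
    have h := congrFun (congrFun hV (s i)) (s j)
    simp only [Matrix.mul_apply, Matrix.transpose_apply, Matrix.submatrix_apply, id,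
      Matrix.one_apply, s.injective.eq_iff] at h ⊢
    exact h
  · ext i j
    have h := congrFun (congrFun hD i) j
    rw [h, Matrix.mul_apply, Matrix.mul_apply]
    simp only [Matrix.mul_diagonal, Matrix.submatrix_apply, Matrix.transpose_apply, id,
      Function.comp]
    exact (Equiv.sum_comp s fun k => V i k * hA.eigenvalues k * V j k).symm
  · intro a b hab
    have := hs hab
    simpa using this

/-- Noise conditions: the rows of the random matrix `N` are independent, mean-zero random vectors,
and row `i` is `ν i`-subgaussian, i.e. `E exp(s uᵀNᵢ) ≤ exp(ν i s² / 2)` for every real `s` and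
every unit vector `u`. -/
structure IsSubgaussianNoise {Ω : Type*} [MeasurableSpace Ω] (μ : Measure Ω) {n T : ℕ}
    (N : Ω → Matrix (Fin n) (Fin T) ℝ) (ν : Fin n → ℝ≥0) : Prop where
  measurable : ∀ i t, Measurable fun ω => N ω i t
  mean_zero : ∀ i t, ∫ ω, N ω i t ∂μ = 0
  indep : iIndepFun (fun (i : Fin n) (ω : Ω) => (N ω i : Fin T → ℝ)) μ
  subgaussian : ∀ (i : Fin n) (u : Fin T → ℝ), ∑ t, u t ^ 2 = 1 →
    HasSubgaussianMGF (fun ω => ∑ t, u t * N ω i t) (ν i) μ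

end CorrNet

end

/-! Let X be the centered rows of Z* scaled to unit length, and E the centered noise rows under the
same scaling. Correlations ignore positive row scalings, so R* = X Xᵀ, while R = B Bᵀ with B the
row-normalization of X + E. If V is a right singular frame of X, then X* = X V and X = X V Vᵀ;
similarly X̂ = B V̂ for a right singular frame V̂ of B. For any rotation Q, X̂ − X* Q = B (V̂ − V Q)
+ (B V − X V) Q. Rows of B are unit vectors, so each row of the first term is at most ‖V̂ − V Q‖ in
operator norm: working with right singular vectors turns a row-wise problem into a plain subspace
perturbation. Only E contributes to the part of V̂ outside the span of V, which therefore has size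
of order ‖E‖/√λ_d; a polar factor supplies Q (`exists_orthogonal_alignment`). Row i of the second
term is of order ‖(E V)ᵢ‖ + ‖E‖² (`l2norm_normalization_error_le`). Together these give
`exists_rotation_row_error_le`.

Bilinear forms of E are subgaussian with proxy 1/(Tγ). Nets and n ≤ C₀T give ‖E‖ ≲ γ^(-1/2)
(`opNorm_tail`), and a union bound over entries gives ‖(E V)ᵢ‖ ≲ √(d log T/(Tγ))
(`projected_rows_tail`).

It remains to compare with the stated rate (`error_le_rate`). The subspace term is at most its
leading factor; so is the projected term, since λ_d ≤ n ≤ C₀T. The quadratic term 1/γ is absorbed by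
the bracket because ‖R*‖_{2,∞} ≥ √λ_d and κ ≥ 1. -/

namespace CorrNet

/-! ### Operator norms, polar factors and alignment of orthonormal frames. -/

section LinearAlgebra

open scoped Matrix.Norms.L2Operator

/-- Euclidean norm of a real vector. -/
noncomputable def l2norm {k : ℕ} (v : Fin k → ℝ) : ℝ := Real.sqrt (∑ i, v i ^ 2)

theorem l2norm_eq_norm {k : ℕ} (v : Fin k → ℝ) : l2norm v = ‖WithLp.toLp 2 v‖ := by
  simp [l2norm, EuclideanSpace.norm_eq]

theorem l2norm_nonneg {k : ℕ} (v : Fin k → ℝ) : 0 ≤ l2norm v := Real.sqrt_nonneg _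

theorem l2norm_sq {k : ℕ} (v : Fin k → ℝ) : l2norm v ^ 2 = ∑ i, v i ^ 2 :=
  Real.sq_sqrt (Finset.sum_nonneg fun _ _ => sq_nonneg _)

theorem l2norm_sq_eq_dotProduct {k : ℕ} (v : Fin k → ℝ) : l2norm v ^ 2 = v ⬝ᵥ v := by
  rw [l2norm_sq]
  simp [dotProduct, sq]

theorem l2norm_add_le {k : ℕ} (v w : Fin k → ℝ) : l2norm (v + w) ≤ l2norm v + l2norm w := by
  simpa [l2norm_eq_norm] using norm_add_le (WithLp.toLp 2 v) (WithLp.toLp 2 w)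

theorem l2norm_smul {k : ℕ} (c : ℝ) (v : Fin k → ℝ) : l2norm (c • v) = |c| * l2norm v := by
  simpa [l2norm_eq_norm] using norm_smul c (WithLp.toLp 2 v)

theorem l2norm_neg {k : ℕ} (v : Fin k → ℝ) : l2norm (-v) = l2norm v := by
  simp [l2norm]

theorem abs_dotProduct_le {k : ℕ} (v w : Fin k → ℝ) : |v ⬝ᵥ w| ≤ l2norm v * l2norm w := by
  have := abs_real_inner_le_norm (WithLp.toLp 2 w : EuclideanSpace ℝ (Fin k)) (WithLp.toLp 2 v)
  simpa [l2norm_eq_norm, mul_comm, EuclideanSpace.inner_eq_star_dotProduct] using this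

theorem l2norm_mulVec_le {n p : ℕ} (A : Matrix (Fin n) (Fin p) ℝ) (x : Fin p → ℝ) :
    l2norm (A *ᵥ x) ≤ ‖A‖ * l2norm x := by
  have := Matrix.l2_opNorm_mulVec A (WithLp.toLp 2 x)
  simpa [l2norm_eq_norm] using this

theorem opNorm_transpose {n p : ℕ} (A : Matrix (Fin n) (Fin p) ℝ) : ‖Aᵀ‖ = ‖A‖ := by
  rw [← Matrix.conjTranspose_eq_transpose_of_trivial, Matrix.l2_opNorm_conjTranspose]

theorem opNorm_transpose_mul_self {n p : ℕ} (A : Matrix (Fin n) (Fin p) ℝ) :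
    ‖Aᵀ * A‖ = ‖A‖ ^ 2 := by
  rw [← Matrix.conjTranspose_eq_transpose_of_trivial, Matrix.l2_opNorm_conjTranspose_mul_self, sq]

theorem l2norm_vecMul_le {n p : ℕ} (A : Matrix (Fin n) (Fin p) ℝ) (x : Fin n → ℝ) :
    l2norm (x ᵥ* A) ≤ l2norm x * ‖A‖ := by
  rw [← Matrix.mulVec_transpose, mul_comm, ← opNorm_transpose A]
  exact l2norm_mulVec_le _ _

theorem opNorm_le_of_mulVec {n p : ℕ} (A : Matrix (Fin n) (Fin p) ℝ) {c : ℝ} (hc : 0 ≤ c)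
    (h : ∀ x, l2norm (A *ᵥ x) ≤ c * l2norm x) : ‖A‖ ≤ c := by
  rw [Matrix.l2_opNorm_def]
  refine ContinuousLinearMap.opNorm_le_bound _ hc fun x => ?_
  have := h x.ofLp
  rw [l2norm_eq_norm, l2norm_eq_norm] at this
  exact this

theorem opNorm_diagonal_le {k : ℕ} (v : Fin k → ℝ) {c : ℝ} (hc : 0 ≤ c) (h : ∀ i, |v i| ≤ c) :
    ‖(Matrix.diagonal v : Matrix (Fin k) (Fin k) ℝ)‖ ≤ c := by
  rw [Matrix.l2_opNorm_diagonal]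
  exact (pi_norm_le_iff_of_nonneg hc).2 h

theorem opNorm_le_one_of_orthonormal {n p : ℕ} {V : Matrix (Fin n) (Fin p) ℝ} (hV : Vᵀ * V = 1) :
    ‖V‖ ≤ 1 := by
  have h := opNorm_transpose_mul_self V
  rw [hV, ← Matrix.diagonal_one] at h
  have h1 := opNorm_diagonal_le (fun _ : Fin p => (1 : ℝ)) zero_le_one (by simp)
  nlinarith [norm_nonneg V]

theorem opNorm_mul_le_of_le {n p q : ℕ} {A : Matrix (Fin n) (Fin p) ℝ}
    {B : Matrix (Fin p) (Fin q) ℝ} {a b : ℝ} (ha : ‖A‖ ≤ a) (hb : ‖B‖ ≤ b) : ‖A * B‖ ≤ a * b :=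
  (Matrix.l2_opNorm_mul A B).trans
    (mul_le_mul ha hb (norm_nonneg _) ((norm_nonneg _).trans ha))

theorem abs_entry_le_opNorm {n p : ℕ} (A : Matrix (Fin n) (Fin p) ℝ) (i : Fin n) (j : Fin p) :
    |A i j| ≤ ‖A‖ := by
  have h1 : |A i j| ≤ l2norm (A *ᵥ Pi.single j 1) := by
    rw [l2norm, ← Real.sqrt_sq_eq_abs]
    refine Real.sqrt_le_sqrt ?_
    have := Finset.single_le_sum (f := fun i => (A *ᵥ Pi.single j 1) i ^ 2)
      (fun _ _ => sq_nonneg _) (Finset.mem_univ i)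
    simpa using this
  have h2 : l2norm (Pi.single j 1 : Fin p → ℝ) = 1 := by
    simp [l2norm_eq_norm]
  simpa [h2] using h1.trans (l2norm_mulVec_le A _)

theorem l2norm_row_le_opNorm {n p : ℕ} (A : Matrix (Fin n) (Fin p) ℝ) (i : Fin n) :
    l2norm (A i) ≤ ‖A‖ := by
  have h := l2norm_vecMul_le A (Pi.single i 1)
  have h2 : l2norm (Pi.single i 1 : Fin n → ℝ) = 1 := by
    simp [l2norm_eq_norm]
  simpa [h2, Matrix.row_def] using h

theorem exists_spectral_decomposition {k : ℕ} (A : Matrix (Fin k) (Fin k) ℝ)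
    (hA : A.IsHermitian) :
    ∃ (O : Matrix (Fin k) (Fin k) ℝ) (s : Fin k → ℝ),
      Oᵀ * O = 1 ∧ A = O * Matrix.diagonal s * Oᵀ := by
  obtain ⟨-, -, O, s, h1, h2, -⟩ := exists_isASE le_rfl A hA
  exact ⟨O, s, h1, h2⟩

/-- A square matrix that is nearly orthogonal is close to its orthogonal polar factor. -/
theorem exists_orthogonal_near {k : ℕ} (H : Matrix (Fin k) (Fin k) ℝ) {ε : ℝ} (hε : ε < 1)
    (hH : ‖1 - Hᵀ * H‖ ≤ ε) :
    ∃ Q : Matrix (Fin k) (Fin k) ℝ, Qᵀ * Q = 1 ∧ ‖H - Q‖ ≤ ε := by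
  have hε0 : 0 ≤ ε := (norm_nonneg _).trans hH
  have hsymm : (Hᵀ * H).IsHermitian := by
    rw [Matrix.IsHermitian, Matrix.conjTranspose_eq_transpose_of_trivial, Matrix.transpose_mul,
      Matrix.transpose_transpose]
  obtain ⟨O, s, hO, hs⟩ := exists_spectral_decomposition _ hsymm
  have hO' : O * Oᵀ = 1 := mul_eq_one_comm.1 hO
  have hS : Oᵀ * (Hᵀ * H) * O = Matrix.diagonal s := by
    rw [hs]
    calc Oᵀ * (O * Matrix.diagonal s * Oᵀ) * O = (Oᵀ * O) * Matrix.diagonal s * (Oᵀ * O) := by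
          simp only [Matrix.mul_assoc]
      _ = _ := by rw [hO]; simp
  have hs1 : ∀ i, |1 - s i| ≤ ε := by
    intro i
    have h1 : Oᵀ * (1 - Hᵀ * H) * O = Matrix.diagonal (fun i => 1 - s i) := by
      rw [Matrix.mul_sub, Matrix.sub_mul, hS, Matrix.mul_one, hO, ← Matrix.diagonal_one,
        Matrix.diagonal_sub]
    have hOn := opNorm_le_one_of_orthonormal hO
    have hOn' : ‖Oᵀ‖ ≤ 1 := by rwa [opNorm_transpose]
    have h2 := opNorm_mul_le_of_le (opNorm_mul_le_of_le hOn' hH) hOn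
    rw [h1] at h2
    have h3 := abs_entry_le_opNorm (Matrix.diagonal (fun i => 1 - s i)) i i
    rw [Matrix.diagonal_apply_eq] at h3
    linarith
  have hspos : ∀ i, 0 < s i := fun i => by
    have := (abs_le.1 (hs1 i)).2
    linarith
  have hsq : ∀ i, Real.sqrt (s i) ≠ 0 := fun i => (Real.sqrt_pos.2 (hspos i)).ne'
  -- O D Oᵀ is (HᵀH)^(-1/2), so the witness below is the polar factor Q = H (HᵀH)^(-1/2), and H − Q
  -- = Q ((HᵀH)^(1/2) − 1).
  set D : Matrix (Fin k) (Fin k) ℝ := Matrix.diagonal fun i => (Real.sqrt (s i))⁻¹ with hD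
  have hDS : D * Matrix.diagonal s * D = 1 := by
    rw [hD, Matrix.diagonal_mul_diagonal, Matrix.diagonal_mul_diagonal, ← Matrix.diagonal_one]
    congr 1
    funext i
    have h := Real.mul_self_sqrt (hspos i).le
    have h0 := hsq i
    calc (Real.sqrt (s i))⁻¹ * s i * (Real.sqrt (s i))⁻¹
        = (Real.sqrt (s i))⁻¹ * (Real.sqrt (s i) * Real.sqrt (s i)) * (Real.sqrt (s i))⁻¹ := by
          rw [h]
      _ = 1 := by field_simp
  have hDt : Dᵀ = D := Matrix.diagonal_transpose _
  have hQ : (H * O * D * Oᵀ)ᵀ * (H * O * D * Oᵀ) = 1 := by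
    calc (H * O * D * Oᵀ)ᵀ * (H * O * D * Oᵀ)
        = O * (D * (Oᵀ * (Hᵀ * H) * O) * D) * Oᵀ := by
          simp only [Matrix.transpose_mul, Matrix.transpose_transpose, Matrix.mul_assoc, hDt]
      _ = 1 := by rw [hS, hDS, Matrix.mul_one, hO']
  refine ⟨H * O * D * Oᵀ, hQ, ?_⟩
  have hfac : H - H * O * D * Oᵀ
      = H * O * D * Oᵀ * (O * Matrix.diagonal (fun i => Real.sqrt (s i) - 1) * Oᵀ) := by
    have h1 : D * Matrix.diagonal (fun i => Real.sqrt (s i) - 1) = 1 - D := by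
      rw [hD, Matrix.diagonal_mul_diagonal, ← Matrix.diagonal_one, Matrix.diagonal_sub]
      congr 1
      funext i
      have h0 := hsq i
      field_simp
    calc H - H * O * D * Oᵀ = H * (O * Oᵀ) - H * O * D * Oᵀ := by rw [hO', Matrix.mul_one]
      _ = H * O * (1 - D) * Oᵀ := by
        rw [Matrix.mul_sub, Matrix.sub_mul, Matrix.mul_one, Matrix.mul_assoc H O Oᵀ]
      _ = H * O * (D * (Oᵀ * O) * Matrix.diagonal (fun i => Real.sqrt (s i) - 1)) * Oᵀ := by
        rw [hO, Matrix.mul_one, h1]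
      _ = _ := by simp only [Matrix.mul_assoc]
  rw [hfac]
  have hOn := opNorm_le_one_of_orthonormal hO
  have hOn' : ‖Oᵀ‖ ≤ 1 := by rwa [opNorm_transpose]
  -- |√s − 1| ≤ |√s − 1| (√s + 1) = |s − 1|.
  have hdiag : ‖(Matrix.diagonal (fun i => Real.sqrt (s i) - 1) : Matrix (Fin k) (Fin k) ℝ)‖ ≤ ε := by
    refine opNorm_diagonal_le _ hε0 fun i => ?_
    have h := Real.mul_self_sqrt (hspos i).le
    have h0 := Real.sqrt_nonneg (s i)
    have h1 : |1 - s i| = |Real.sqrt (s i) - 1| * (Real.sqrt (s i) + 1) := by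
      rw [abs_sub_comm, show s i - 1 = (Real.sqrt (s i) - 1) * (Real.sqrt (s i) + 1) by nlinarith,
        abs_mul, abs_of_nonneg (by linarith : (0 : ℝ) ≤ Real.sqrt (s i) + 1)]
    have := hs1 i
    rw [h1] at this
    nlinarith [abs_nonneg (Real.sqrt (s i) - 1)]
  have := opNorm_mul_le_of_le (opNorm_le_one_of_orthonormal hQ)
    (opNorm_mul_le_of_le (opNorm_mul_le_of_le hOn hdiag) hOn')
  simpa using this

/-- Two orthonormal frames with nearly equal column spaces agree up to a rotation. -/
theorem exists_orthogonal_alignment {T d : ℕ} {V W : Matrix (Fin T) (Fin d) ℝ}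
    (hV : Vᵀ * V = 1) (hW : Wᵀ * W = 1) {δ : ℝ} (hδ1 : δ < 1) (hδ : ‖W - V * (Vᵀ * W)‖ ≤ δ) :
    ∃ Q : Matrix (Fin d) (Fin d) ℝ, Qᵀ * Q = 1 ∧ ‖W - V * Q‖ ≤ 2 * δ := by
  have hδ0 : 0 ≤ δ := (norm_nonneg _).trans hδ
  -- The Gram matrix of the residual is exactly the defect of VᵀW from being orthogonal.
  have hG : (W - V * (Vᵀ * W))ᵀ * (W - V * (Vᵀ * W)) = 1 - (Vᵀ * W)ᵀ * (Vᵀ * W) := by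
    have h1 : (W - V * (Vᵀ * W))ᵀ * (W - V * (Vᵀ * W))
        = Wᵀ * W - (Wᵀ * V) * (Vᵀ * W) - (Wᵀ * V) * (Vᵀ * W)
          + (Wᵀ * V) * (Vᵀ * V) * (Vᵀ * W) := by
      simp only [Matrix.transpose_sub, Matrix.transpose_mul, Matrix.transpose_transpose,
        Matrix.mul_sub, Matrix.sub_mul, Matrix.mul_assoc]
      abel
    rw [h1, hV, hW, Matrix.mul_one, Matrix.transpose_mul, Matrix.transpose_transpose]
    abel
  -- The defect is at most δ², hence at most δ as δ < 1.
  have hH : ‖1 - (Vᵀ * W)ᵀ * (Vᵀ * W)‖ ≤ δ := by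
    rw [← hG, opNorm_transpose_mul_self]
    nlinarith [norm_nonneg (W - V * (Vᵀ * W))]
  obtain ⟨Q, hQ, hHQ⟩ := exists_orthogonal_near _ hδ1 hH
  refine ⟨Q, hQ, ?_⟩
  have h1 : W - V * Q = (W - V * (Vᵀ * W)) + V * (Vᵀ * W - Q) := by
    rw [Matrix.mul_sub]; abel
  rw [h1]
  have h2 := opNorm_mul_le_of_le (opNorm_le_one_of_orthonormal hV) hHQ
  linarith [norm_add_le (W - V * (Vᵀ * W)) (V * (Vᵀ * W - Q))]

end LinearAlgebra

end CorrNet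

namespace CorrNet

/-! ### Deterministic perturbation of the embedding. -/

section Perturbation

open scoped Matrix.Norms.L2Operator

theorem lastEig_le {d : ℕ} (hd : 0 < d) {lam : Fin d → ℝ} (h : Antitone lam) (k : Fin d) :
    lastEig hd lam ≤ lam k :=
  h (Fin.le_def.2 (by have := k.2; simp only; omega))

/-- The right singular frame of a matrix whose Gram matrix has a given spectral decomposition. -/
theorem exists_right_frame {n T d : ℕ} {X : Matrix (Fin n) (Fin T) ℝ}
    {U : Matrix (Fin n) (Fin d) ℝ} {lam : Fin d → ℝ} (h : IsReducedSpectral (X * Xᵀ) U lam) :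
    ∃ V : Matrix (Fin T) (Fin d) ℝ, Vᵀ * V = 1 ∧ X * V = embedding U lam ∧ X * V * Vᵀ = X := by
  have hr : ∀ k, Real.sqrt (lam k) ≠ 0 := fun k => (Real.sqrt_pos.2 (h.pos k)).ne'
  have hr2 : ∀ k, Real.sqrt (lam k) * Real.sqrt (lam k) = lam k :=
    fun k => Real.mul_self_sqrt (h.pos k).le
  set D : Matrix (Fin d) (Fin d) ℝ := Matrix.diagonal fun k => (Real.sqrt (lam k))⁻¹ with hD
  set S : Matrix (Fin d) (Fin d) ℝ := Matrix.diagonal fun k => Real.sqrt (lam k) with hS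
  have hSS : S * S = Matrix.diagonal lam := by
    rw [hS, Matrix.diagonal_mul_diagonal]; simp [hr2]
  have hSD : S * D = 1 := by
    rw [hS, hD, Matrix.diagonal_mul_diagonal, ← Matrix.diagonal_one]
    congr 1; funext k; exact mul_inv_cancel₀ (hr k)
  have hDS : D * S = 1 := mul_eq_one_comm.1 hSD
  have hDt : Dᵀ = D := Matrix.diagonal_transpose _
  have hSt : Sᵀ = S := Matrix.diagonal_transpose _
  have hXXU : X * Xᵀ * U = U * (S * S) := by
    rw [h.decomp, hSS, Matrix.mul_assoc, h.orthonormal, Matrix.mul_one]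
  have hXV : X * (Xᵀ * U * D) = U * S := by
    calc X * (Xᵀ * U * D) = X * Xᵀ * U * D := by simp only [Matrix.mul_assoc]
      _ = U * S * (S * D) := by rw [hXXU]; simp only [Matrix.mul_assoc]
      _ = _ := by rw [hSD, Matrix.mul_one]
  have hV : (Xᵀ * U * D)ᵀ * (Xᵀ * U * D) = 1 := by
    calc (Xᵀ * U * D)ᵀ * (Xᵀ * U * D) = D * (Uᵀ * (X * (Xᵀ * U * D))) := by
          simp only [Matrix.transpose_mul, Matrix.transpose_transpose, Matrix.mul_assoc, hDt]
      _ = D * (Uᵀ * U) * S := by rw [hXV]; simp only [Matrix.mul_assoc]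
      _ = 1 := by rw [h.orthonormal, Matrix.mul_one, hDS]
  refine ⟨Xᵀ * U * D, hV, hXV, ?_⟩
  set V := Xᵀ * U * D
  -- X = X V Vᵀ follows because the residual of Xᵀ off the span of V has zero Gram matrix: (X V)(X
  -- V)ᵀ already equals X Xᵀ.
  have hGG : (Xᵀ - V * (Vᵀ * Xᵀ))ᵀ * (Xᵀ - V * (Vᵀ * Xᵀ)) = 0 := by
    have h1 : (Xᵀ - V * (Vᵀ * Xᵀ))ᵀ * (Xᵀ - V * (Vᵀ * Xᵀ))
        = X * Xᵀ - (X * V) * (X * V)ᵀ - (X * V) * (X * V)ᵀ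
          + (X * V) * (Vᵀ * V) * (X * V)ᵀ := by
      simp only [Matrix.transpose_sub, Matrix.transpose_mul, Matrix.transpose_transpose,
        Matrix.mul_sub, Matrix.sub_mul, Matrix.mul_assoc]
      abel
    have h2 : (X * V) * (X * V)ᵀ = X * Xᵀ := by
      rw [hXV, h.decomp, ← hSS, Matrix.transpose_mul, hSt]
      simp only [Matrix.mul_assoc]
    rw [h1, hV, Matrix.mul_one, h2]
    abel
  have hG : Xᵀ - V * (Vᵀ * Xᵀ) = 0 := by
    rw [← norm_eq_zero]
    have := opNorm_transpose_mul_self (Xᵀ - V * (Vᵀ * Xᵀ))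
    rw [hGG, norm_zero] at this
    exact pow_eq_zero_iff two_ne_zero |>.1 this.symm
  have := congrArg Matrix.transpose (sub_eq_zero.1 hG)
  rw [Matrix.transpose_mul, Matrix.transpose_mul, Matrix.transpose_transpose,
    Matrix.transpose_transpose] at this
  exact this.symm

theorem l2norm_mulVec_of_orthonormal {n p : ℕ} {V : Matrix (Fin n) (Fin p) ℝ} (hV : Vᵀ * V = 1)
    (x : Fin p → ℝ) : l2norm (V *ᵥ x) = l2norm x := by
  rw [← sq_eq_sq₀ (l2norm_nonneg _) (l2norm_nonneg _), l2norm_sq_eq_dotProduct,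
    l2norm_sq_eq_dotProduct, Matrix.dotProduct_mulVec, Matrix.vecMul_mulVec, ← Matrix.mulVec_transpose]
  simp [hV]

/-- Expand xᵀ X Xᵀ x. Orthonormality of W plays no role, so this serves both the reduced
decomposition of X Xᵀ and the full eigenbasis of B Bᵀ. -/
theorem l2norm_transpose_mulVec_sq {n T p : ℕ} {X : Matrix (Fin n) (Fin T) ℝ}
    {W : Matrix (Fin n) (Fin p) ℝ} {θ : Fin p → ℝ} (h : X * Xᵀ = W * Matrix.diagonal θ * Wᵀ)
    (x : Fin n → ℝ) : l2norm (Xᵀ *ᵥ x) ^ 2 = ∑ k, θ k * (Wᵀ *ᵥ x) k ^ 2 := by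
  have h1 : l2norm (Xᵀ *ᵥ x) ^ 2 = x ⬝ᵥ (X * Xᵀ) *ᵥ x := by
    rw [l2norm_sq_eq_dotProduct, ← Matrix.mulVec_mulVec, Matrix.dotProduct_mulVec x,
      Matrix.mulVec_transpose]
  rw [h1, h, ← Matrix.mulVec_mulVec, ← Matrix.mulVec_mulVec, Matrix.dotProduct_mulVec x,
    ← Matrix.mulVec_transpose]
  simp only [dotProduct, Matrix.mulVec_diagonal]
  exact Finset.sum_congr rfl fun k _ => by ring

theorem sqrt_lastEig_mul_le {n T d : ℕ} (hd : 0 < d) {X : Matrix (Fin n) (Fin T) ℝ}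
    {U : Matrix (Fin n) (Fin d) ℝ} {lam : Fin d → ℝ} (h : IsReducedSpectral (X * Xᵀ) U lam)
    (a : Fin d → ℝ) :
    Real.sqrt (lastEig hd lam) * l2norm a ≤ l2norm (Xᵀ *ᵥ (U *ᵥ a)) := by
  have hL : 0 < lastEig hd lam := h.pos _
  rw [← sq_le_sq₀ (mul_nonneg (Real.sqrt_nonneg _) (l2norm_nonneg _)) (l2norm_nonneg _), mul_pow,
    Real.sq_sqrt hL.le, l2norm_transpose_mulVec_sq h.decomp, l2norm_sq, Finset.mul_sum,
    Matrix.mulVec_mulVec, h.orthonormal, Matrix.one_mulVec]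
  exact Finset.sum_le_sum fun k _ =>
    mul_le_mul_of_nonneg_right (lastEig_le hd h.antitone k) (sq_nonneg _)

/-- Makes the ordering by magnitude in `IsASE` an ordinary ordering of eigenvalues. -/
theorem eigenvalue_nonneg_of_gram {n T : ℕ} {B : Matrix (Fin n) (Fin T) ℝ}
    {W : Matrix (Fin n) (Fin n) ℝ} {θ : Fin n → ℝ} (hW : Wᵀ * W = 1)
    (h : B * Bᵀ = W * Matrix.diagonal θ * Wᵀ) (j : Fin n) : 0 ≤ θ j := by
  have h1 := l2norm_transpose_mulVec_sq h (W *ᵥ Pi.single j 1)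
  rw [Matrix.mulVec_mulVec _ Wᵀ W, hW, Matrix.one_mulVec] at h1
  have h2 : ∑ k, θ k * (Pi.single j 1 : Fin n → ℝ) k ^ 2 = θ j := by
    rw [Finset.sum_eq_single j] <;> simp +contextual
  rw [← h2, ← h1]
  positivity

/-- Lower bound for the leading `d` eigenvalues of a Gram matrix through a `d`-dimensional family
of test vectors. -/
theorem le_eigenvalue_of_test_space {n T d : ℕ} (hd : 0 < d) (hdn : d ≤ n)
    {B : Matrix (Fin n) (Fin T) ℝ} {W : Matrix (Fin n) (Fin n) ℝ} {θ : Fin n → ℝ}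
    (hW : Wᵀ * W = 1) (h : B * Bᵀ = W * Matrix.diagonal θ * Wᵀ) (hθ : Antitone fun j => |θ j|)
    (F : Matrix (Fin n) (Fin d) ℝ) {c C : ℝ} (hc : 0 ≤ c)
    (h1 : ∀ a, c * l2norm a ≤ l2norm (Bᵀ *ᵥ (F *ᵥ a)))
    (h2 : ∀ a, l2norm (F *ᵥ a) ≤ C * l2norm a) (k : Fin d) :
    c ^ 2 ≤ C ^ 2 * θ (Fin.castLE hdn k) := by
  have hθ0 := eigenvalue_nonneg_of_gram hW h
  have hθa : Antitone θ := fun i j hij => by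
    have := hθ hij
    simpa [abs_of_nonneg (hθ0 _)] using this
  let l : Fin d := ⟨d - 1, Nat.sub_lt hd Nat.one_pos⟩
  -- Courant–Fischer by dimension count: zeroing the last row makes G singular, and a kernel vector
  -- a gives F a orthogonal to the first d − 1 eigenvectors, so its quadratic form is at most θ_d ‖F
  -- a‖².
  let G : Matrix (Fin d) (Fin d) ℝ :=
    Matrix.of fun i j => if i = l then 0 else (Wᵀ * F) (Fin.castLE hdn i) j
  have hG : G.det = 0 := Matrix.det_eq_zero_of_row_eq_zero l fun j => by simp [G]
  obtain ⟨a, ha, hGa⟩ := Matrix.exists_mulVec_eq_zero_iff.2 hG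
  have hapos : 0 < l2norm a := by
    refine lt_of_le_of_ne (l2norm_nonneg _) fun h0 => ha ?_
    rw [l2norm_eq_norm, eq_comm, norm_eq_zero] at h0
    simpa using h0
  have hzero : ∀ j : Fin n, j < Fin.castLE hdn l → (Wᵀ *ᵥ (F *ᵥ a)) j = 0 := by
    intro j hj
    have hj' : (j : ℕ) < d - 1 := hj
    let i : Fin d := ⟨j, by omega⟩
    have hi : i ≠ l := fun h => by
      have := congrArg Fin.val h
      simp only [i, l] at this
      omega
    have := congrFun hGa i
    rw [Matrix.mulVec_mulVec]
    simpa [Matrix.mulVec, dotProduct, G, hi, i] using this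
  have hsum : l2norm (Bᵀ *ᵥ (F *ᵥ a)) ^ 2 ≤ θ (Fin.castLE hdn l) * l2norm (F *ᵥ a) ^ 2 := by
    have hW' : (Wᵀ)ᵀ * Wᵀ = 1 := by rw [Matrix.transpose_transpose]; exact mul_eq_one_comm.1 hW
    rw [l2norm_transpose_mulVec_sq h, ← l2norm_mulVec_of_orthonormal hW', l2norm_sq,
      Finset.mul_sum]
    refine Finset.sum_le_sum fun j _ => ?_
    by_cases hj : j < Fin.castLE hdn l
    · simp [hzero j hj]
    · exact mul_le_mul_of_nonneg_right (hθa (not_lt.1 hj)) (sq_nonneg _)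
  have hkl : θ (Fin.castLE hdn l) ≤ θ (Fin.castLE hdn k) := hθa (by
    have := k.2
    simp only [Fin.le_def, Fin.val_castLE, l]; omega)
  have e1 : (c * l2norm a) ^ 2 ≤ l2norm (Bᵀ *ᵥ (F *ᵥ a)) ^ 2 :=
    pow_le_pow_left₀ (mul_nonneg hc hapos.le) (h1 a) 2
  have e2 : l2norm (F *ᵥ a) ^ 2 ≤ (C * l2norm a) ^ 2 :=
    pow_le_pow_left₀ (l2norm_nonneg _) (h2 a) 2
  have e3 := mul_le_mul_of_nonneg_left e2 (hθ0 (Fin.castLE hdn l))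
  have e4 : c ^ 2 * l2norm a ^ 2 ≤ (C ^ 2 * θ (Fin.castLE hdn l)) * l2norm a ^ 2 := by
    nlinarith
  have e5 := le_of_mul_le_mul_right e4 (by positivity)
  nlinarith [mul_le_mul_of_nonneg_left hkl (sq_nonneg C)]

theorem half_le_l2norm_add {T : ℕ} {x e : Fin T → ℝ} (hx : l2norm x = 1)
    (he : l2norm e ≤ 1 / 2) : 1 / 2 ≤ l2norm (x + e) := by
  have h1 := l2norm_add_le (x + e) (-e)
  rw [l2norm_neg, add_neg_cancel_right] at h1
  linarith

/-- Since x lies in the span of V, ⟨x, e⟩ = ⟨Vᵀx, Vᵀe⟩ is at most b. As ρ² = 1 + 2⟨x, e⟩ + ‖e‖², the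
length of x + e feels the full noise e only to second order; this is what keeps a first-order η out
of the bound. The constant is (4b + 2η²) from the rescaling plus 2b from the projected noise. -/
theorem l2norm_normalization_error_le {T d : ℕ} {x e : Fin T → ℝ} {V : Matrix (Fin T) (Fin d) ℝ}
    (hx : l2norm x = 1) (hxV : x ᵥ* V ᵥ* Vᵀ = x) (hV : ‖V‖ ≤ 1) {η b : ℝ} (he : l2norm e ≤ η)
    (hη : η ≤ 1 / 2) (hb : l2norm (e ᵥ* V) ≤ b) :
    l2norm (((l2norm (x + e))⁻¹ - 1) • (x ᵥ* V) + (l2norm (x + e))⁻¹ • (e ᵥ* V))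
      ≤ 6 * b + 2 * η ^ 2 := by
  set ρ := l2norm (x + e) with hρ
  have hρ1 : 1 / 2 ≤ ρ := half_le_l2norm_add hx (he.trans hη)
  have hρ0 : 0 < ρ := by linarith
  have hs2 : ρ⁻¹ ≤ 2 := by rw [inv_le_comm₀ hρ0 two_pos]; linarith
  have hxV1 : l2norm (x ᵥ* V) ≤ 1 := by
    have := l2norm_vecMul_le V x
    rw [hx] at this
    linarith
  have hb0 : 0 ≤ b := (l2norm_nonneg _).trans hb
  have hxe : |x ⬝ᵥ e| ≤ b := by
    have e1 : x ⬝ᵥ e = (x ᵥ* V) ⬝ᵥ (e ᵥ* V) := by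
      rw [← Matrix.mulVec_transpose V e, Matrix.dotProduct_mulVec, hxV]
    rw [e1]
    refine (abs_dotProduct_le _ _).trans ?_
    calc _ ≤ 1 * b := mul_le_mul hxV1 hb (l2norm_nonneg _) zero_le_one
      _ = b := one_mul b
  have hρsq : ρ ^ 2 = 1 + 2 * (x ⬝ᵥ e) + l2norm e ^ 2 := by
    have e2 := l2norm_sq_eq_dotProduct x
    rw [hx] at e2
    rw [hρ, l2norm_sq_eq_dotProduct, add_dotProduct, dotProduct_add, dotProduct_add, ← e2,
      l2norm_sq_eq_dotProduct, dotProduct_comm e x]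
    ring
  have hesq : l2norm e ^ 2 ≤ η ^ 2 := pow_le_pow_left₀ (l2norm_nonneg _) he 2
  have hρsq' : |1 - ρ ^ 2| ≤ 2 * b + η ^ 2 := by
    have := abs_le.1 hxe
    rw [hρsq, abs_le]
    constructor <;> linarith [sq_nonneg (l2norm e), sq_nonneg η]
  have hs1 : |ρ⁻¹ - 1| ≤ 4 * b + 2 * η ^ 2 := by
    have e1 : ρ⁻¹ - 1 = ρ⁻¹ * (1 - ρ) := by
      rw [mul_sub, inv_mul_cancel₀ hρ0.ne', mul_one]
    have e2 : |1 - ρ| ≤ |1 - ρ ^ 2| := by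
      rw [show 1 - ρ ^ 2 = (1 - ρ) * (1 + ρ) by ring, abs_mul,
        abs_of_pos (by linarith : 0 < 1 + ρ)]
      exact le_mul_of_one_le_right (abs_nonneg _) (by linarith)
    rw [e1, abs_mul, abs_of_pos (inv_pos.2 hρ0)]
    calc _ ≤ 2 * (2 * b + η ^ 2) :=
          mul_le_mul hs2 (e2.trans hρsq') (abs_nonneg _) zero_le_two
      _ = _ := by ring
  refine (l2norm_add_le _ _).trans ?_
  rw [l2norm_smul, l2norm_smul, abs_of_pos (inv_pos.2 hρ0)]
  have e1 := mul_le_mul hs1 hxV1 (l2norm_nonneg _) (by positivity)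
  have e2 := mul_le_mul hs2 hb (l2norm_nonneg _) zero_le_two
  linarith

/-- Deterministic row-wise error bound for the spectral embedding of the Gram matrix of the
normalized rows of `X + E`. -/
theorem exists_rotation_row_error_le {n T d : ℕ} (hd : 0 < d) {X E : Matrix (Fin n) (Fin T) ℝ}
    {U : Matrix (Fin n) (Fin d) ℝ} {lam : Fin d → ℝ} (hX : ∀ i, l2norm (X i) = 1)
    (h : IsReducedSpectral (X * Xᵀ) U lam) {V : Matrix (Fin T) (Fin d) ℝ} (hV : Vᵀ * V = 1)
    (hXV : X * V = embedding U lam) (hXVV : X * V * Vᵀ = X) {η b : ℝ} (hE : ‖E‖ ≤ η)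
    (hη : η ≤ 1 / 2) (hηL : 32 * η ≤ Real.sqrt (lastEig hd lam))
    (hb : ∀ i, l2norm ((E * V) i) ≤ b) {Xhat : Matrix (Fin n) (Fin d) ℝ}
    (hXhat : IsASE (Matrix.of fun i j =>
      ((X + E) * (X + E)ᵀ) i j / (l2norm ((X + E) i) * l2norm ((X + E) j))) Xhat) :
    ∃ Q ∈ Matrix.orthogonalGroup (Fin d) ℝ, ∀ i,
      l2norm ((Xhat - embedding U lam * Q) i)
        ≤ 32 * η / Real.sqrt (lastEig hd lam) + 6 * b + 2 * η ^ 2 := by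
  have hη0 : 0 ≤ η := (norm_nonneg _).trans hE
  set L := lastEig hd lam with hLdef
  have hL : 0 < L := h.pos _
  have hLs : 0 < Real.sqrt L := Real.sqrt_pos.2 hL
  obtain ⟨hdn, W, θ, hW, hdec, hanti, rfl⟩ := hXhat
  set Y := X + E with hY
  set ρ : Fin n → ℝ := fun i => l2norm (Y i) with hρ
  have hEi : ∀ i, l2norm (E i) ≤ η := fun i => (l2norm_row_le_opNorm E i).trans hE
  have hYi : ∀ i, Y i = X i + E i := fun i => rfl
  have hρ2 : ∀ i, ρ i ≤ 2 := fun i => by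
    have := l2norm_add_le (X i) (E i)
    simp only [hρ, hYi]
    linarith [hX i, hEi i]
  have hρ1 : ∀ i, 1 / 2 ≤ ρ i := fun i =>
    half_le_l2norm_add (hX i) ((hEi i).trans hη)
  have hρ0 : ∀ i, 0 < ρ i := fun i => by linarith [hρ1 i]
  have hs2 : ∀ i, (ρ i)⁻¹ ≤ 2 := fun i => by
    rw [inv_le_comm₀ (hρ0 i) two_pos]; linarith [hρ1 i]
  set S : Matrix (Fin n) (Fin n) ℝ := Matrix.diagonal fun i => (ρ i)⁻¹ with hS
  have hSt : Sᵀ = S := Matrix.diagonal_transpose _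
  have hSn : ‖S‖ ≤ 2 := opNorm_diagonal_le _ zero_le_two fun i => by
    rw [abs_of_pos (inv_pos.2 (hρ0 i))]; exact hs2 i
  set B := S * Y with hB
  have hBt : Bᵀ = Yᵀ * S := by rw [hB, Matrix.transpose_mul, hSt]
  have hBi : ∀ i, B i = (ρ i)⁻¹ • Y i := fun i => by
    funext t
    simp [hB, hS, Matrix.diagonal_mul]
  have hdec : B * Bᵀ = W * Matrix.diagonal θ * Wᵀ := by
    rw [← hdec]
    ext i j
    have hij : (Y * Yᵀ) i j = Y i ⬝ᵥ Y j := rfl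
    have : (B * Bᵀ) i j = B i ⬝ᵥ B j := rfl
    rw [this, hBi, hBi, Matrix.of_apply, hij, smul_dotProduct, dotProduct_smul, smul_eq_mul,
      smul_eq_mul, div_eq_mul_inv, mul_inv]
    ring
  have hθ0 := eigenvalue_nonneg_of_gram hW hdec
  have hU : ‖U‖ ≤ 1 := opNorm_le_one_of_orthonormal h.orthonormal
  -- lower bound on the leading eigenvalues
  have hθL : ∀ k, L / 16 ≤ θ (Fin.castLE hdn k) := by
    intro k
    have hDρ : ‖(Matrix.diagonal ρ : Matrix (Fin n) (Fin n) ℝ)‖ ≤ 2 :=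
      opNorm_diagonal_le _ zero_le_two fun i => by rw [abs_of_pos (hρ0 i)]; exact hρ2 i
    have hSD : S * Matrix.diagonal ρ = 1 := by
      rw [hS, Matrix.diagonal_mul_diagonal, ← Matrix.diagonal_one]
      congr 1; funext i; exact inv_mul_cancel₀ (hρ0 i).ne'
    -- The test space diag(ρ) U undoes the normalization: Bᵀ diag(ρ) U = (X + E)ᵀ U. There the form
    -- is at least √L − η ≥ √L/2, and diag(ρ) costs a factor 2, whence L/16.
    have key := le_eigenvalue_of_test_space hd hdn hW hdec hanti (Matrix.diagonal ρ * U)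
      (c := Real.sqrt L / 2) (C := 2) (by positivity) ?_ ?_ k
    · rw [div_pow, Real.sq_sqrt hL.le] at key
      linarith
    · intro a
      have e1 : Bᵀ *ᵥ ((Matrix.diagonal ρ * U) *ᵥ a) = Xᵀ *ᵥ (U *ᵥ a) + Eᵀ *ᵥ (U *ᵥ a) := by
        rw [Matrix.mulVec_mulVec, hBt, Matrix.mul_assoc, ← Matrix.mul_assoc S, hSD,
          Matrix.one_mul, hY, Matrix.transpose_add, Matrix.add_mul, Matrix.add_mulVec,
          Matrix.mulVec_mulVec, Matrix.mulVec_mulVec]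
      have e2 := l2norm_add_le (Xᵀ *ᵥ (U *ᵥ a) + Eᵀ *ᵥ (U *ᵥ a)) (-(Eᵀ *ᵥ (U *ᵥ a)))
      rw [l2norm_neg, add_neg_cancel_right] at e2
      have e3 := l2norm_mulVec_le Eᵀ (U *ᵥ a)
      rw [l2norm_mulVec_of_orthonormal h.orthonormal, opNorm_transpose] at e3
      have e4 := sqrt_lastEig_mul_le hd h a
      rw [e1]
      have e5 := mul_le_mul_of_nonneg_right hE (l2norm_nonneg a)
      have e6 := mul_le_mul_of_nonneg_right hηL (l2norm_nonneg a)
      have e7 := mul_nonneg hη0 (l2norm_nonneg a)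
      nlinarith
    · intro a
      refine (l2norm_mulVec_le _ _).trans (mul_le_mul_of_nonneg_right ?_ (l2norm_nonneg _))
      simpa using opNorm_mul_le_of_le hDρ hU
  set ϑ : Fin d → ℝ := fun k => θ (Fin.castLE hdn k) with hϑ
  have hϑpos : ∀ k, 0 < ϑ k := fun k => lt_of_lt_of_le (by positivity) (hθL k)
  have hr : ∀ k, Real.sqrt (ϑ k) ≠ 0 := fun k => (Real.sqrt_pos.2 (hϑpos k)).ne'
  set A : Matrix (Fin n) (Fin d) ℝ := W.submatrix id (Fin.castLE hdn) with hA
  set D : Matrix (Fin d) (Fin d) ℝ := Matrix.diagonal fun k => (Real.sqrt (ϑ k))⁻¹ with hD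
  set M : Matrix (Fin d) (Fin d) ℝ := Matrix.diagonal fun k => Real.sqrt (ϑ k) with hM
  have hDt : Dᵀ = D := Matrix.diagonal_transpose _
  have hMD : M * D = 1 := by
    rw [hM, hD, Matrix.diagonal_mul_diagonal, ← Matrix.diagonal_one]
    congr 1; funext k; exact mul_inv_cancel₀ (hr k)
  have hDM : D * M = 1 := mul_eq_one_comm.1 hMD
  have hMM : M * M = Matrix.diagonal ϑ := by
    rw [hM, Matrix.diagonal_mul_diagonal]
    congr 1; funext k; exact Real.mul_self_sqrt (hϑpos k).le
  have hDn : ‖D‖ ≤ 4 / Real.sqrt L := opNorm_diagonal_le _ (by positivity) fun k => by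
    rw [abs_of_pos (inv_pos.2 (Real.sqrt_pos.2 (hϑpos k))), inv_le_comm₀
      (Real.sqrt_pos.2 (hϑpos k)) (by positivity), inv_div]
    have : Real.sqrt (L / 16) = Real.sqrt L / 4 := by
      rw [Real.sqrt_div hL.le, show (16 : ℝ) = 4 ^ 2 by norm_num, Real.sqrt_sq (by norm_num)]
    rw [← this]
    exact Real.sqrt_le_sqrt (hθL k)
  have hAA : Aᵀ * A = 1 := by
    ext i j
    have := congrFun (congrFun hW (Fin.castLE hdn i)) (Fin.castLE hdn j)
    simpa [Matrix.mul_apply, hA, Matrix.one_apply] using this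
  have hAn := opNorm_le_one_of_orthonormal hAA
  have hBBA : B * Bᵀ * A = A * (M * M) := by
    have e1 : W * Matrix.diagonal θ * Wᵀ * W = W * Matrix.diagonal θ := by
      rw [Matrix.mul_assoc, hW, Matrix.mul_one]
    rw [hdec, hMM]
    ext i k
    have := congrFun (congrFun e1 i) (Fin.castLE hdn k)
    rw [Matrix.mul_diagonal] at this
    rw [Matrix.mul_diagonal]
    exact this
  have hemb : (Matrix.of fun i k =>
      W i (Fin.castLE hdn k) * Real.sqrt |θ (Fin.castLE hdn k)| : Matrix (Fin n) (Fin d) ℝ)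
      = A * M := by
    ext i k
    rw [hM, Matrix.mul_diagonal]
    simp [hA, hϑ, abs_of_nonneg (hθ0 _)]
  -- The right singular frame of B attached to the chosen eigenvectors; it turns the embedding into
  -- B V̂.
  set Vh : Matrix (Fin T) (Fin d) ℝ := Bᵀ * A * D with hVh
  have hBV : B * Vh = A * M := by
    calc B * Vh = B * Bᵀ * A * D := by rw [hVh]; simp only [Matrix.mul_assoc]
      _ = A * M * (M * D) := by rw [hBBA]; simp only [Matrix.mul_assoc]
      _ = A * M := by rw [hMD, Matrix.mul_one]
  have hVV : Vhᵀ * Vh = 1 := by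
    calc Vhᵀ * Vh = D * (Aᵀ * (B * Vh)) := by
          rw [hVh]
          simp only [Matrix.transpose_mul, Matrix.transpose_transpose, Matrix.mul_assoc, hDt]
      _ = D * (Aᵀ * A) * M := by rw [hBV]; simp only [Matrix.mul_assoc]
      _ = 1 := by rw [hAA, Matrix.mul_one, hDM]
  have hVn := opNorm_le_one_of_orthonormal hV
  -- distance between the two column spaces
  have hδ : ‖Vh - V * (Vᵀ * Vh)‖ ≤ 16 * η / Real.sqrt L := by
    have hXt : V * (Vᵀ * Xᵀ) = Xᵀ := by
      have := congrArg Matrix.transpose hXVV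
      rwa [Matrix.transpose_mul, Matrix.transpose_mul, Matrix.transpose_transpose] at this
    -- 1 − V Vᵀ annihilates Xᵀ, so only the noise survives. The factors 2η, ‖S‖ ≤ 2, ‖A‖ ≤ 1 and ‖D‖
    -- ≤ 4/√L multiply to 16η/√L.
    have e1 : Vh - V * (Vᵀ * Vh) = (Eᵀ - V * (Vᵀ * Eᵀ)) * (S * (A * D)) := by
      have e2 : Vh = (Xᵀ + Eᵀ) * (S * (A * D)) := by
        rw [hVh, hBt, hY, Matrix.transpose_add]; simp only [Matrix.mul_assoc]
      have e3 : V * (Vᵀ * ((Xᵀ + Eᵀ) * (S * (A * D))))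
          = (V * (Vᵀ * Xᵀ) + V * (Vᵀ * Eᵀ)) * (S * (A * D)) := by
        simp only [Matrix.add_mul, Matrix.mul_add, Matrix.mul_assoc]
      rw [e2, e3, hXt, ← Matrix.sub_mul]
      congr 1
      abel
    have hEt : ‖Eᵀ‖ ≤ η := by rwa [opNorm_transpose]
    have hVt : ‖Vᵀ‖ ≤ 1 := by rwa [opNorm_transpose]
    have e4 := opNorm_mul_le_of_le hVn (opNorm_mul_le_of_le hVt hEt)
    have e5 : ‖Eᵀ - V * (Vᵀ * Eᵀ)‖ ≤ 2 * η := by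
      linarith [norm_sub_le Eᵀ (V * (Vᵀ * Eᵀ))]
    have e6 := opNorm_mul_le_of_le e5 (opNorm_mul_le_of_le hSn (opNorm_mul_le_of_le hAn hDn))
    rw [e1]
    refine e6.trans (le_of_eq ?_)
    ring
  have hδ1 : 16 * η / Real.sqrt L < 1 := by
    rw [div_lt_one hLs]; linarith
  obtain ⟨Q, hQ, hVQ⟩ := exists_orthogonal_alignment hV hVV hδ1 hδ
  refine ⟨Q, (Matrix.mem_orthogonalGroup_iff' (Fin d) ℝ).2 hQ, fun i => ?_⟩
  have hQn := opNorm_le_one_of_orthonormal hQ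
  have hrow : (Matrix.of (fun i k => W i (Fin.castLE hdn k) * Real.sqrt |θ (Fin.castLE hdn k)|)
      - embedding U lam * Q) i
      = B i ᵥ* (Vh - V * Q)
        + (((ρ i)⁻¹ - 1) • (X i ᵥ* V) + (ρ i)⁻¹ • (E * V) i) ᵥ* Q := by
    rw [hemb, ← hBV, ← hXV]
    have e1 : B * Vh - X * V * Q = B * (Vh - V * Q) + (B * V - X * V) * Q := by
      simp only [Matrix.mul_sub, Matrix.sub_mul, Matrix.mul_assoc]; abel
    have e2 : (B * V - X * V) i = ((ρ i)⁻¹ - 1) • (X i ᵥ* V) + (ρ i)⁻¹ • (E * V) i := by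
      have e3 : (B * V - X * V) i = B i ᵥ* V - X i ᵥ* V := rfl
      have e4 : (E * V) i = E i ᵥ* V := rfl
      rw [e3, e4, hBi, hYi, Matrix.smul_vecMul, Matrix.add_vecMul, smul_add, sub_smul, one_smul]
      abel
    rw [e1, ← e2]
    rfl
  rw [hrow]
  have hB1 : l2norm (B i) = 1 := by
    rw [hBi, l2norm_smul, abs_of_pos (inv_pos.2 (hρ0 i))]
    exact inv_mul_cancel₀ (hρ0 i).ne'
  have t1 : l2norm (B i ᵥ* (Vh - V * Q)) ≤ 32 * η / Real.sqrt L := by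
    refine (l2norm_vecMul_le _ _).trans ?_
    rw [hB1, one_mul]
    refine hVQ.trans (le_of_eq (by ring))
  have t2 : l2norm (((ρ i)⁻¹ - 1) • (X i ᵥ* V) + (ρ i)⁻¹ • (E * V) i) ≤ 6 * b + 2 * η ^ 2 :=
    l2norm_normalization_error_le (hX i) (congrFun hXVV i) hVn (hEi i) hη (hb i)
  have t3 := l2norm_vecMul_le Q (((ρ i)⁻¹ - 1) • (X i ᵥ* V) + (ρ i)⁻¹ • (E * V) i)
  have t4 := mul_le_mul t2 hQn (norm_nonneg _) ((l2norm_nonneg _).trans t2)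
  refine (l2norm_add_le _ _).trans ?_
  linarith

end Perturbation

end CorrNet

namespace CorrNet

/-! ### Concentration of the scaled noise. -/

section Noise

open scoped Matrix.Norms.L2Operator

/-- The Euclidean unit ball has a `1 / 2`-net with at most `5 ^ k` elements. -/
theorem exists_half_net (k : ℕ) :
    ∃ F : Finset (Fin k → ℝ), F.card ≤ 5 ^ k ∧ (∀ v ∈ F, l2norm v ≤ 1) ∧
      ∀ x, l2norm x ≤ 1 → ∃ v ∈ F, l2norm (x - v) ≤ 1 / 2 := by
  classical
  let E := EuclideanSpace ℝ (Fin k)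
  -- A 1-separated set of maximal size in the ball of radius 2 is a 1-net of that ball; halving it
  -- gives the net.
  let P : Finset E → Prop := fun s =>
    (∀ c ∈ s, ‖c‖ ≤ 2) ∧ ∀ c ∈ s, ∀ d ∈ s, c ≠ d → 1 ≤ ‖c - d‖
  have hcard : ∀ s, P s → s.card ≤ 5 ^ k := fun s hs => by
    have := Besicovitch.card_le_of_separated s hs.1 hs.2
    simpa [E] using this
  obtain ⟨s, hs, hmax⟩ : ∃ s, P s ∧ ∀ s', P s' → s'.card ≤ s.card := by
    have hne : {m | ∃ s, P s ∧ s.card = m}.Nonempty := ⟨0, ∅, by simp [P], rfl⟩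
    have hbdd : BddAbove {m | ∃ s, P s ∧ s.card = m} :=
      ⟨5 ^ k, by rintro m ⟨s, hs, rfl⟩; exact hcard s hs⟩
    obtain ⟨s, hs, hsm⟩ := Nat.sSup_mem hne hbdd
    exact ⟨s, hs, fun s' hs' => hsm ▸ le_csSup hbdd ⟨s', hs', rfl⟩⟩
  have hcover : ∀ x : E, ‖x‖ ≤ 2 → ∃ c ∈ s, ‖x - c‖ ≤ 1 := by
    intro x hx
    by_contra! hfar
    have hxs : x ∉ s := fun hxs => by
      have := hfar x hxs
      simp at this
      linarith
    have hP : P (insert x s) := by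
      refine ⟨fun c hc => ?_, fun c hc d hd hcd => ?_⟩
      · rcases Finset.mem_insert.1 hc with rfl | hc
        · exact hx
        · exact hs.1 c hc
      · rcases Finset.mem_insert.1 hc with rfl | hc <;> rcases Finset.mem_insert.1 hd with rfl | hd
        · exact absurd rfl hcd
        · exact (hfar d ‹_›).le
        · rw [norm_sub_rev]; exact (hfar c ‹_›).le
        · exact hs.2 c hc d hd hcd
    have := hmax _ hP
    rw [Finset.card_insert_of_notMem hxs] at this
    omega
  refine ⟨s.image fun c => (1 / 2 : ℝ) • c.ofLp, Finset.card_image_le.trans (hcard s hs), ?_, ?_⟩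
  · intro v hv
    obtain ⟨c, hc, rfl⟩ := Finset.mem_image.1 hv
    have := hs.1 c hc
    rw [l2norm_smul, l2norm_eq_norm]
    rw [abs_of_pos (by norm_num)]
    simp only [WithLp.toLp_ofLp]
    linarith
  · intro x hx
    obtain ⟨c, hc, hxc⟩ := hcover (WithLp.toLp 2 ((2 : ℝ) • x)) (by
      rw [← l2norm_eq_norm, l2norm_smul, abs_of_pos two_pos]; linarith)
    refine ⟨_, Finset.mem_image_of_mem _ hc, ?_⟩
    have e1 : x - (1 / 2 : ℝ) • c.ofLp = (1 / 2 : ℝ) • ((2 : ℝ) • x - c.ofLp) := by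
      rw [smul_sub, smul_smul]; norm_num
    rw [e1, l2norm_smul, l2norm_eq_norm, abs_of_pos (by norm_num)]
    have e2 : (WithLp.toLp 2 ((2 : ℝ) • x - c.ofLp) : E) = WithLp.toLp 2 ((2 : ℝ) • x) - c := rfl
    rw [e2]
    linarith

theorem l2norm_le_of_net {k : ℕ} {F : Finset (Fin k → ℝ)}
    (hF : ∀ x, l2norm x ≤ 1 → ∃ v ∈ F, l2norm (x - v) ≤ 1 / 2) (w : Fin k → ℝ) {t : ℝ}
    (hw : ∀ u ∈ F, u ⬝ᵥ w ≤ t) : l2norm w ≤ 2 * t := by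
  rcases eq_or_ne (l2norm w) 0 with h0 | h0
  · have hw0 : w = 0 := by
      rw [l2norm_eq_norm, norm_eq_zero] at h0
      simpa using h0
    obtain ⟨u, hu, -⟩ := hF 0 (by simp [l2norm])
    have := hw u hu
    rw [hw0, dotProduct_zero] at this
    rw [h0]; linarith
  · have hpos : 0 < l2norm w := lt_of_le_of_ne (l2norm_nonneg _) h0.symm
    obtain ⟨u, hu, hxu⟩ := hF ((l2norm w)⁻¹ • w) (by
      rw [l2norm_smul, abs_of_pos (inv_pos.2 hpos), inv_mul_cancel₀ h0])
    have e1 : ((l2norm w)⁻¹ • w) ⬝ᵥ w = l2norm w := by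
      rw [smul_dotProduct, ← l2norm_sq_eq_dotProduct, smul_eq_mul, sq, inv_mul_cancel_left₀ h0]
    have e2 := (abs_le.1 (abs_dotProduct_le ((l2norm w)⁻¹ • w - u) w)).2
    rw [sub_dotProduct, e1] at e2
    have e3 := mul_le_mul_of_nonneg_right hxu hpos.le
    linarith [hw u hu]

theorem opNorm_le_of_nets {n T : ℕ} {F : Finset (Fin n → ℝ)} {G : Finset (Fin T → ℝ)}
    (hF : ∀ x, l2norm x ≤ 1 → ∃ v ∈ F, l2norm (x - v) ≤ 1 / 2)
    (hG : ∀ x, l2norm x ≤ 1 → ∃ v ∈ G, l2norm (x - v) ≤ 1 / 2)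
    (E : Matrix (Fin n) (Fin T) ℝ) {t : ℝ} (ht : 0 ≤ t)
    (h : ∀ u ∈ F, ∀ v ∈ G, u ⬝ᵥ (E *ᵥ v) ≤ t) : ‖E‖ ≤ 4 * t := by
  -- The net in the source leaves an error ‖E‖/2, which is absorbed into the left side at the end;
  -- each net costs a factor 2.
  have hball : ∀ x, l2norm x ≤ 1 → l2norm (E *ᵥ x) ≤ 2 * t + ‖E‖ / 2 := by
    intro x hx
    obtain ⟨v, hv, hxv⟩ := hG x hx
    have e1 := l2norm_le_of_net hF (E *ᵥ v) fun u hu => h u hu v hv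
    have e2 := l2norm_add_le (E *ᵥ v) (E *ᵥ (x - v))
    rw [← Matrix.mulVec_add, add_sub_cancel] at e2
    have e3 := l2norm_mulVec_le E (x - v)
    have e4 := mul_le_mul_of_nonneg_left hxv (norm_nonneg E)
    linarith
  have := opNorm_le_of_mulVec E (c := 2 * t + ‖E‖ / 2) (by positivity) fun x => by
    rcases eq_or_ne (l2norm x) 0 with h0 | h0
    · have := l2norm_mulVec_le E x
      rw [h0] at this ⊢
      linarith
    · have hpos : 0 < l2norm x := lt_of_le_of_ne (l2norm_nonneg _) h0.symm
      have e1 := hball ((l2norm x)⁻¹ • x) (by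
        rw [l2norm_smul, abs_of_pos (inv_pos.2 hpos), inv_mul_cancel₀ h0])
      rw [Matrix.mulVec_smul, l2norm_smul, abs_of_pos (inv_pos.2 hpos), inv_mul_le_iff₀ hpos] at e1
      linarith
  linarith

/-- Rows centered about their time averages and scaled by `a`. -/
noncomputable def scaledRows {n T : ℕ} (a : Fin n → ℝ) (Z : Matrix (Fin n) (Fin T) ℝ) :
    Matrix (Fin n) (Fin T) ℝ :=
  Matrix.of fun i t => a i * (Z i t - timeMean (Z i))

theorem scaledRows_add {n T : ℕ} (a : Fin n → ℝ) (Z Z' : Matrix (Fin n) (Fin T) ℝ) :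
    scaledRows a (Z + Z') = scaledRows a Z + scaledRows a Z' := by
  ext i t
  simp only [scaledRows, timeMean, Matrix.of_apply, Matrix.add_apply, Finset.sum_add_distrib]
  ring

/-- Centering is self-adjoint, so it can be moved from the noise onto a deterministic test vector,
where it is a contraction. -/
theorem sum_centered_mul {T : ℕ} (z v : Fin T → ℝ) :
    ∑ t, (z t - timeMean z) * v t = ∑ t, (v t - timeMean v) * z t := by
  simp only [sub_mul, Finset.sum_sub_distrib, ← Finset.mul_sum, timeMean]
  have : ∑ t, z t * v t = ∑ t, v t * z t := Finset.sum_congr rfl fun _ _ => mul_comm _ _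
  rw [this]
  ring

theorem l2norm_centered_le {T : ℕ} (v : Fin T → ℝ) :
    l2norm (fun t => v t - timeMean v) ≤ l2norm v := by
  rw [← sq_le_sq₀ (l2norm_nonneg _) (l2norm_nonneg _), l2norm_sq, l2norm_sq]
  rcases Nat.eq_zero_or_pos T with rfl | hT
  · simp
  have hT' : (T : ℝ) ≠ 0 := by positivity
  have e1 : ∑ t, v t = T * timeMean v := by
    rw [timeMean]; field_simp
  have e2 : ∑ t, (v t - timeMean v) ^ 2 = ∑ t, v t ^ 2 - T * timeMean v ^ 2 := by
    have : ∀ t, (v t - timeMean v) ^ 2 = v t ^ 2 - 2 * timeMean v * v t + timeMean v ^ 2 :=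
      fun t => by ring
    simp only [this, Finset.sum_add_distrib, Finset.sum_sub_distrib, ← Finset.mul_sum, e1]
    simp
    ring
  rw [e2]
  have : 0 ≤ (T : ℝ) * timeMean v ^ 2 := by positivity
  linarith

theorem hasSubgaussianMGF_mono {Ω : Type*} [MeasurableSpace Ω] {μ : Measure Ω} {X : Ω → ℝ}
    {c c' : ℝ≥0} (h : HasSubgaussianMGF X c μ) (hc : c ≤ c') : HasSubgaussianMGF X c' μ where
  integrable_exp_mul := h.integrable_exp_mul
  mgf_le t := (h.mgf_le t).trans <| Real.exp_le_exp.2 <| by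
    have : (c : ℝ) ≤ c' := hc
    gcongr

theorem hasSubgaussianMGF_const_mul_of_le {Ω : Type*} [MeasurableSpace Ω] {μ : Measure Ω}
    {X : Ω → ℝ} {c c' : ℝ≥0} (h : HasSubgaussianMGF X c μ) (r : ℝ) (hc : r ^ 2 * (c : ℝ) ≤ c') :
    HasSubgaussianMGF (fun ω => r * X ω) c' μ :=
  hasSubgaussianMGF_mono (h.const_mul r) (NNReal.coe_le_coe.1 hc)

variable {Ω : Type*} [MeasurableSpace Ω] {μ : Measure Ω} [IsProbabilityMeasure μ] {n T : ℕ}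
  {N : Ω → Matrix (Fin n) (Fin T) ℝ} {ν : Fin n → ℝ≥0}

theorem IsSubgaussianNoise.row (h : IsSubgaussianNoise μ N ν) (i : Fin n) {w : Fin T → ℝ}
    (hw : l2norm w ≤ 1) : HasSubgaussianMGF (fun ω => ∑ t, w t * N ω i t) (ν i) μ := by
  rcases eq_or_ne (l2norm w) 0 with h0 | h0
  · have hw0 : w = 0 := by
      rw [l2norm_eq_norm, norm_eq_zero] at h0
      simpa using h0
    subst hw0
    simpa using hasSubgaussianMGF_mono (HasSubgaussianMGF.fun_zero (μ := μ)) (zero_le (a := ν i))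
  · have hpos : 0 < l2norm w := lt_of_le_of_ne (l2norm_nonneg _) h0.symm
    have hu := h.subgaussian i (fun t => (l2norm w)⁻¹ * w t) (by
      simp only [mul_pow, ← Finset.mul_sum, ← l2norm_sq]
      field_simp)
    have := hasSubgaussianMGF_const_mul_of_le hu (l2norm w) (c' := ν i) (by
      have : l2norm w ^ 2 ≤ 1 := pow_le_one₀ hpos.le hw
      nlinarith [(ν i).coe_nonneg])
    refine this.congr (ae_of_all _ fun ω => ?_)
    simp only [Finset.mul_sum]
    refine Finset.sum_congr rfl fun t _ => ?_
    field_simp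

/-- The form is a sum of independent terms uᵢ aᵢ ⟨w, Nᵢ⟩, with w the centered v. Their proxies uᵢ²
aᵢ² νᵢ sum to at most g since ‖u‖ ≤ 1; entries within a row may be dependent. -/
theorem IsSubgaussianNoise.bilinear (h : IsSubgaussianNoise μ N ν) {a : Fin n → ℝ} {g : ℝ≥0}
    (ha : ∀ i, a i ^ 2 * (ν i : ℝ) ≤ g) {u : Fin n → ℝ} {v : Fin T → ℝ} (hu : l2norm u ≤ 1)
    (hv : l2norm v ≤ 1) :
    HasSubgaussianMGF (fun ω => u ⬝ᵥ (scaledRows a (N ω) *ᵥ v)) g μ := by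
  set w : Fin T → ℝ := fun t => v t - timeMean v with hwdef
  have hw : l2norm w ≤ 1 := (l2norm_centered_le v).trans hv
  have hind : iIndepFun (fun i ω => u i * a i * ∑ t, w t * N ω i t) μ :=
    h.indep.comp (fun i z => u i * a i * ∑ t, w t * z t) fun i => by fun_prop
  have hsum := HasSubgaussianMGF.sum_of_iIndepFun hind (s := Finset.univ)
    (c := fun i => Real.toNNReal (u i ^ 2) * g)
    fun i _ => hasSubgaussianMGF_const_mul_of_le (h.row i hw) (u i * a i) (by
      rw [NNReal.coe_mul, Real.coe_toNNReal _ (sq_nonneg _), mul_pow, mul_assoc]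
      exact mul_le_mul_of_nonneg_left (ha i) (sq_nonneg _))
  refine hasSubgaussianMGF_mono (hsum.congr (ae_of_all _ fun ω => ?_)) ?_
  · simp only [dotProduct, Matrix.mulVec, scaledRows, Matrix.of_apply, mul_assoc,
      ← Finset.mul_sum]
    refine Finset.sum_congr rfl fun i _ => ?_
    rw [sum_centered_mul]
  · rw [← NNReal.coe_le_coe, NNReal.coe_sum]
    calc ∑ i, ((Real.toNNReal (u i ^ 2) * g : ℝ≥0) : ℝ) = ∑ i, u i ^ 2 * (g : ℝ) := by
          refine Finset.sum_congr rfl fun i _ => ?_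
          rw [NNReal.coe_mul, Real.coe_toNNReal _ (sq_nonneg _)]
      _ = l2norm u ^ 2 * g := by rw [← Finset.sum_mul, l2norm_sq]
      _ ≤ 1 * g := mul_le_mul_of_nonneg_right (pow_le_one₀ (l2norm_nonneg _) hu) g.coe_nonneg
      _ = g := one_mul _

theorem IsSubgaussianNoise.tail (h : IsSubgaussianNoise μ N ν) {a : Fin n → ℝ} {g : ℝ≥0}
    (ha : ∀ i, a i ^ 2 * (ν i : ℝ) ≤ g) {u : Fin n → ℝ} {v : Fin T → ℝ} (hu : l2norm u ≤ 1)
    (hv : l2norm v ≤ 1) {t : ℝ} (ht : 0 ≤ t) :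
    μ.real {ω | t ≤ u ⬝ᵥ (scaledRows a (N ω) *ᵥ v)} ≤ Real.exp (-t ^ 2 / (2 * g)) :=
  (h.bilinear ha hu hv).measure_ge_le ht

/-- Tail bound for the operator norm of the noise. -/
theorem IsSubgaussianNoise.opNorm_tail (h : IsSubgaussianNoise μ N ν) {a : Fin n → ℝ} {g : ℝ≥0}
    (ha : ∀ i, a i ^ 2 * (ν i : ℝ) ≤ g) {t : ℝ} (ht : 0 ≤ t) :
    μ.real {ω | ¬ ‖scaledRows a (N ω)‖ ≤ 4 * t}
      ≤ 5 ^ n * 5 ^ T * Real.exp (-t ^ 2 / (2 * g)) := by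
  obtain ⟨F, hFc, hF1, hF⟩ := exists_half_net n
  obtain ⟨G, hGc, hG1, hG⟩ := exists_half_net T
  have hsub : {ω | ¬ ‖scaledRows a (N ω)‖ ≤ 4 * t}
      ⊆ ⋃ p ∈ F ×ˢ G, {ω | t ≤ p.1 ⬝ᵥ (scaledRows a (N ω) *ᵥ p.2)} := by
    intro ω hω
    by_contra hcon
    refine hω (opNorm_le_of_nets hF hG _ ht fun u hu v hv => ?_)
    by_contra hlt
    exact hcon (Set.mem_biUnion (x := (u, v)) (Finset.mem_product.2 ⟨hu, hv⟩) (not_le.1 hlt).le)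
  calc _ ≤ μ.real (⋃ p ∈ F ×ˢ G, {ω | t ≤ p.1 ⬝ᵥ (scaledRows a (N ω) *ᵥ p.2)}) :=
        measureReal_mono hsub (measure_ne_top _ _)
    _ ≤ ∑ p ∈ F ×ˢ G, μ.real {ω | t ≤ p.1 ⬝ᵥ (scaledRows a (N ω) *ᵥ p.2)} :=
        measureReal_biUnion_finset_le _ _
    _ ≤ ∑ p ∈ F ×ˢ G, Real.exp (-t ^ 2 / (2 * g)) := Finset.sum_le_sum fun p hp =>
        h.tail ha (hF1 _ (Finset.mem_product.1 hp).1) (hG1 _ (Finset.mem_product.1 hp).2) ht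
    _ = (F.card * G.card : ℝ) * Real.exp (-t ^ 2 / (2 * g)) := by
        rw [Finset.sum_const, Finset.card_product, nsmul_eq_mul, Nat.cast_mul]
    _ ≤ _ := by
        have h1 : (F.card : ℝ) ≤ 5 ^ n := by exact_mod_cast hFc
        have h2 : (G.card : ℝ) ≤ 5 ^ T := by exact_mod_cast hGc
        gcongr

/-- Tail bound for the rows of the noise projected on an orthonormal frame. -/
theorem IsSubgaussianNoise.projected_rows_tail (h : IsSubgaussianNoise μ N ν) {a : Fin n → ℝ}
    {g : ℝ≥0} (ha : ∀ i, a i ^ 2 * (ν i : ℝ) ≤ g) {d : ℕ} {V : Matrix (Fin T) (Fin d) ℝ}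
    (hV : Vᵀ * V = 1) {b : ℝ} (hb : 0 ≤ b) :
    μ.real {ω | ¬ ∀ i, l2norm ((scaledRows a (N ω) * V) i) ≤ Real.sqrt d * b}
      ≤ 2 * (n * d) * Real.exp (-b ^ 2 / (2 * g)) := by
  have hcol : ∀ k, l2norm (fun t => V t k) = 1 := fun k => by
    rw [← Real.sqrt_one, l2norm]
    congr 1
    have := congrFun (congrFun hV k) k
    simpa [Matrix.mul_apply, sq] using this
  -- Both signs are needed because the tail bound is one-sided; this is the factor 2 in the union
  -- bound.
  let s : Bool → ℝ := fun β => if β then 1 else -1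
  have hsingle : ∀ (β : Bool) (i : Fin n), l2norm (s β • (Pi.single i 1 : Fin n → ℝ)) ≤ 1 := by
    intro β i
    have : l2norm (Pi.single i 1 : Fin n → ℝ) = 1 := by simp [l2norm_eq_norm]
    rw [l2norm_smul, this]
    cases β <;> simp [s]
  have hval : ∀ ω (β : Bool) i k, (s β • (Pi.single i 1 : Fin n → ℝ)) ⬝ᵥ
      (scaledRows a (N ω) *ᵥ fun t => V t k) = s β * (scaledRows a (N ω) * V) i k := by
    intro ω β i k
    rw [smul_dotProduct, single_one_dotProduct, smul_eq_mul]
    rfl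
  have hsub : {ω | ¬ ∀ i, l2norm ((scaledRows a (N ω) * V) i) ≤ Real.sqrt d * b}
      ⊆ ⋃ p ∈ (Finset.univ : Finset (Bool × Fin n × Fin d)),
        {ω | b ≤ (s p.1 • (Pi.single p.2.1 1 : Fin n → ℝ)) ⬝ᵥ
          (scaledRows a (N ω) *ᵥ fun t => V t p.2.2)} := by
    intro ω hω
    by_contra hcon
    refine hω fun i => ?_
    have hent : ∀ k, (scaledRows a (N ω) * V) i k ^ 2 ≤ b ^ 2 := by
      intro k
      refine sq_le_sq' ?_ ?_
      · by_contra hlt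
        refine hcon (Set.mem_biUnion (x := (false, i, k)) (Finset.mem_univ _) ?_)
        rw [Set.mem_ofPred_eq, hval]
        simp only [s, Bool.false_eq_true, if_false]
        linarith
      · by_contra hlt
        refine hcon (Set.mem_biUnion (x := (true, i, k)) (Finset.mem_univ _) ?_)
        rw [Set.mem_ofPred_eq, hval]
        simp only [s, if_true]
        linarith
    rw [l2norm, ← Real.sqrt_sq hb, ← Real.sqrt_mul (Nat.cast_nonneg d)]
    refine Real.sqrt_le_sqrt ((Finset.sum_le_sum fun k _ => hent k).trans (le_of_eq ?_))
    simp
  calc _ ≤ _ := measureReal_mono hsub (measure_ne_top _ _)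
    _ ≤ _ := measureReal_biUnion_finset_le _ _
    _ ≤ ∑ p ∈ (Finset.univ : Finset (Bool × Fin n × Fin d)), Real.exp (-b ^ 2 / (2 * g)) :=
        Finset.sum_le_sum fun p _ => h.tail ha (hsingle _ _) (hcol _).le hb
    _ = _ := by simp

end Noise

end CorrNet

namespace CorrNet

/-! ### Correlation matrices as Gram matrices and their spectra. -/

section Correlation

/-- Positive row scalings cancel, so the observed data may be scaled by the deterministic powers of
the signal; the noise then enters additively and linearly. -/
theorem corrMatrix_eq_normalized_gram {n T : ℕ} (hT : 0 < T) {a : Fin n → ℝ} (ha : ∀ i, 0 < a i)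
    (Z : Matrix (Fin n) (Fin T) ℝ) :
    corrMatrix Z = Matrix.of fun i j => (scaledRows a Z * (scaledRows a Z)ᵀ) i j
      / (l2norm (scaledRows a Z i) * l2norm (scaledRows a Z j)) := by
  have hT' : (0 : ℝ) < 1 / T := by positivity
  have hl : ∀ i, l2norm (scaledRows a Z i)
      = a i * Real.sqrt (∑ t, (Z i t - timeMean (Z i)) ^ 2) := by
    intro i
    have : scaledRows a Z i = a i • fun t => Z i t - timeMean (Z i) := rfl
    rw [this, l2norm_smul, abs_of_pos (ha i), l2norm]
  ext i j
  have hg : (scaledRows a Z * (scaledRows a Z)ᵀ) i j = (a i * a j) *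
      ∑ t, (Z i t - timeMean (Z i)) * (Z j t - timeMean (Z j)) := by
    simp only [Matrix.mul_apply, scaledRows, Matrix.transpose_apply, Matrix.of_apply,
      Finset.mul_sum]
    exact Finset.sum_congr rfl fun t _ => by ring
  rw [Matrix.of_apply, hl, hl, hg]
  have h1 : a i * Real.sqrt (∑ t, (Z i t - timeMean (Z i)) ^ 2)
      * (a j * Real.sqrt (∑ t, (Z j t - timeMean (Z j)) ^ 2))
      = (a i * a j) * (Real.sqrt (∑ t, (Z i t - timeMean (Z i)) ^ 2)
        * Real.sqrt (∑ t, (Z j t - timeMean (Z j)) ^ 2)) := by ring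
  rw [h1, mul_div_mul_left _ _ (mul_pos (ha i) (ha j)).ne']
  simp only [corrMatrix, Matrix.of_apply, sampleCov, sampleVar]
  rw [Real.sqrt_mul hT'.le, Real.sqrt_mul hT'.le, mul_mul_mul_comm, Real.mul_self_sqrt hT'.le,
    mul_div_mul_left _ _ hT'.ne']

/-- The scaling that makes the centered rows of `Z` unit vectors. -/
noncomputable def unitScale {n T : ℕ} (Z : Matrix (Fin n) (Fin T) ℝ) (i : Fin n) : ℝ :=
  (Real.sqrt (T * sampleVar (Z i)))⁻¹

variable {n T : ℕ} {Z : Matrix (Fin n) (Fin T) ℝ}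

theorem unitScale_pos (hT : 0 < T) (hZ : ∀ i, 0 < sampleVar (Z i)) (i : Fin n) :
    0 < unitScale Z i := by
  have := hZ i
  exact inv_pos.2 (Real.sqrt_pos.2 (by positivity))

theorem unitScale_sq (hZ : ∀ i, 0 < sampleVar (Z i)) (i : Fin n) :
    unitScale Z i ^ 2 = (T * sampleVar (Z i))⁻¹ := by
  have := hZ i
  rw [unitScale, inv_pow, Real.sq_sqrt (by positivity)]

theorem l2norm_scaledRows_unitScale (hT : 0 < T) (hZ : ∀ i, 0 < sampleVar (Z i)) (i : Fin n) :
    l2norm (scaledRows (unitScale Z) Z i) = 1 := by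
  have hT' : (0 : ℝ) < T := by positivity
  have h0 := hZ i
  rw [← sq_eq_sq₀ (l2norm_nonneg _) zero_le_one, one_pow, l2norm_sq]
  simp only [scaledRows, Matrix.of_apply, mul_pow, ← Finset.mul_sum, unitScale_sq hZ]
  have : ∑ t, (Z i t - timeMean (Z i)) ^ 2 = T * sampleVar (Z i) := by
    rw [sampleVar]; field_simp
  rw [this]
  exact inv_mul_cancel₀ (by positivity)

theorem corrMatrix_eq_gram (hT : 0 < T) (hZ : ∀ i, 0 < sampleVar (Z i)) :
    corrMatrix Z = scaledRows (unitScale Z) Z * (scaledRows (unitScale Z) Z)ᵀ := by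
  rw [corrMatrix_eq_normalized_gram hT (unitScale_pos hT hZ)]
  ext i j
  rw [Matrix.of_apply, l2norm_scaledRows_unitScale hT hZ, l2norm_scaledRows_unitScale hT hZ,
    mul_one, div_one]

theorem corrMatrix_diag (hT : 0 < T) (hZ : ∀ i, 0 < sampleVar (Z i)) (i : Fin n) :
    corrMatrix Z i i = 1 := by
  have h : corrMatrix Z i i = scaledRows (unitScale Z) Z i ⬝ᵥ scaledRows (unitScale Z) Z i := by
    rw [corrMatrix_eq_gram hT hZ]; rfl
  rw [h, ← l2norm_sq_eq_dotProduct, l2norm_scaledRows_unitScale hT hZ, one_pow]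

theorem mul_diagonal_mul_transpose_diag {n d : ℕ} (U : Matrix (Fin n) (Fin d) ℝ) (v : Fin d → ℝ)
    (i : Fin n) : (U * Matrix.diagonal v * Uᵀ) i i = ∑ k, v k * U i k ^ 2 := by
  rw [Matrix.mul_apply]
  refine Finset.sum_congr rfl fun k _ => ?_
  rw [Matrix.mul_diagonal, Matrix.transpose_apply]
  ring

theorem IsReducedSpectral.size_pos {d : ℕ} (hd : 0 < d) {A : Matrix (Fin n) (Fin n) ℝ}
    {U : Matrix (Fin n) (Fin d) ℝ} {lam : Fin d → ℝ} (h : IsReducedSpectral A U lam) : 0 < n := by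
  rcases Nat.eq_zero_or_pos n with rfl | hn
  · have := congrFun (congrFun h.orthonormal ⟨0, hd⟩) ⟨0, hd⟩
    simp [Matrix.mul_apply] at this
  · exact hn

/-- The trace n is the sum of the positive eigenvalues. -/
theorem IsReducedSpectral.lastEig_le_size {d : ℕ} (hd : 0 < d) {A : Matrix (Fin n) (Fin n) ℝ}
    {U : Matrix (Fin n) (Fin d) ℝ} {lam : Fin d → ℝ} (h : IsReducedSpectral A U lam)
    (hA : ∀ i, A i i = 1) : lastEig hd lam ≤ n := by
  have h1 : A.trace = n := by simp [Matrix.trace, hA]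
  have h2 : A.trace = ∑ k, lam k := by
    rw [h.decomp, Matrix.trace_mul_comm, ← Matrix.mul_assoc, h.orthonormal, Matrix.one_mul,
      Matrix.trace_diagonal]
  rw [← h1, h2]
  exact Finset.single_le_sum (f := lam) (fun k _ => (h.pos k).le) (Finset.mem_univ _)

theorem l2norm_row_le_twoInfNorm {n p : ℕ} (B : Matrix (Fin n) (Fin p) ℝ) (i : Fin n) :
    l2norm (B i) ≤ twoInfNorm B :=
  le_ciSup (f := fun i => l2norm (B i)) (Set.finite_range _).bddAbove i

theorem twoInfNorm_le {n p : ℕ} {B : Matrix (Fin n) (Fin p) ℝ} {c : ℝ} (hc : 0 ≤ c)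
    (h : ∀ i, l2norm (B i) ≤ c) : twoInfNorm B ≤ c :=
  Real.iSup_le h hc

/-- Every row satisfies ‖Aᵢ‖² = Σ λ_k² U_ik² ≥ λ_d Σ λ_k U_ik² = λ_d Aᵢᵢ = λ_d. -/
theorem IsReducedSpectral.sqrt_lastEig_le_twoInfNorm {d : ℕ} (hd : 0 < d)
    {A : Matrix (Fin n) (Fin n) ℝ} {U : Matrix (Fin n) (Fin d) ℝ} {lam : Fin d → ℝ}
    (h : IsReducedSpectral A U lam) (hA : ∀ i, A i i = 1) :
    Real.sqrt (lastEig hd lam) ≤ twoInfNorm A := by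
  let i : Fin n := ⟨0, h.size_pos hd⟩
  refine le_trans ?_ (l2norm_row_le_twoInfNorm A i)
  refine Real.sqrt_le_sqrt ?_
  have h1 : A * Aᵀ = U * Matrix.diagonal (fun k => lam k * lam k) * Uᵀ := by
    calc A * Aᵀ = U * Matrix.diagonal lam * (Uᵀ * U) * Matrix.diagonal lam * Uᵀ := by
          rw [h.decomp]
          simp only [Matrix.transpose_mul, Matrix.transpose_transpose, Matrix.diagonal_transpose,
            Matrix.mul_assoc]
      _ = _ := by
          rw [h.orthonormal, Matrix.mul_one, Matrix.mul_assoc U, Matrix.diagonal_mul_diagonal]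
  have h2 : ∑ k, A i k ^ 2 = ∑ k, lam k * lam k * U i k ^ 2 := by
    rw [← mul_diagonal_mul_transpose_diag U (fun k => lam k * lam k) i, ← h1, Matrix.mul_apply]
    simp [sq]
  have h3 : ∑ k, lam k * U i k ^ 2 = 1 := by
    rw [← mul_diagonal_mul_transpose_diag, ← h.decomp, hA]
  rw [h2]
  calc lastEig hd lam = ∑ k, lastEig hd lam * (lam k * U i k ^ 2) := by
        rw [← Finset.mul_sum, h3, mul_one]
    _ ≤ _ := Finset.sum_le_sum fun k _ => by
        rw [mul_assoc]
        exact mul_le_mul_of_nonneg_right (lastEig_le hd h.antitone k)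
          (mul_nonneg (h.pos k).le (sq_nonneg _))

theorem IsReducedSpectral.one_le_condNumber {d : ℕ} (hd : 0 < d) {A : Matrix (Fin n) (Fin n) ℝ}
    {U : Matrix (Fin n) (Fin d) ℝ} {lam : Fin d → ℝ} (h : IsReducedSpectral A U lam) :
    1 ≤ condNumber hd lam :=
  (one_le_div (h.pos _)).2 (lastEig_le hd h.antitone _)

/-- For a `1 × 1` matrix with entry `1` the embedding is determined up to sign. -/
theorem exists_rotation_eq_of_size_one {d : ℕ} (hd : 0 < d) {A A' : Matrix (Fin 1) (Fin 1) ℝ}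
    {U : Matrix (Fin 1) (Fin d) ℝ} {lam : Fin d → ℝ} (h : IsReducedSpectral A U lam)
    (hA : A 0 0 = 1) (hA' : A' 0 0 = 1) {Xhat : Matrix (Fin 1) (Fin d) ℝ} (hX : IsASE A' Xhat) :
    ∃ Q ∈ Matrix.orthogonalGroup (Fin d) ℝ, Xhat - embedding U lam * Q = 0 := by
  obtain ⟨hdn, W, θ, hW, hdec, -, rfl⟩ := hX
  obtain rfl : d = 1 := by omega
  have hW0 : W 0 0 * W 0 0 = 1 := by
    simpa [Matrix.mul_apply] using congrFun (congrFun hW 0) 0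
  have hU0 : U 0 0 * U 0 0 = 1 := by
    simpa [Matrix.mul_apply] using congrFun (congrFun h.orthonormal 0) 0
  have hθ : θ 0 = 1 := by
    have := congrFun (congrFun hdec 0) 0
    rw [mul_diagonal_mul_transpose_diag, hA'] at this
    simp only [Fin.sum_univ_one] at this
    linear_combination -this - θ 0 * hW0
  have hlam : lam 0 = 1 := by
    have := congrFun (congrFun h.decomp 0) 0
    rw [mul_diagonal_mul_transpose_diag, hA] at this
    simp only [Fin.sum_univ_one] at this
    linear_combination -this - lam 0 * hU0
  refine ⟨Matrix.of fun _ _ => U 0 0 * W 0 0, ?_, ?_⟩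
  · rw [Matrix.mem_orthogonalGroup_iff']
    ext i j
    fin_cases i; fin_cases j
    simp [Matrix.mul_apply]
    linear_combination W 0 0 * W 0 0 * hU0 + hW0
  · ext i j
    fin_cases i; fin_cases j
    simp [embedding, Matrix.mul_apply, hθ, hlam]
    linear_combination -W 0 0 * hU0

end Correlation

/-! ### Comparison with the target rate and numerical tail bounds. -/

section Bounds

/-- Comparison of the deterministic error with the target rate. -/
theorem error_le_rate {C₀ T n d γ L κ ρ η b : ℝ} (hC₀ : 1 ≤ C₀) (hT : 0 < T)
    (hlogT : 1 ≤ Real.log T) (hn : 2 ≤ n) (hnT : n ≤ C₀ * T) (hd : 1 ≤ d) (hγ : 0 < γ)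
    (hL : 0 < L) (hLn : L ≤ n) (hκ : 1 ≤ κ) (hρ : Real.sqrt L ≤ ρ)
    (hη : η = 4 * Real.sqrt (4 * (C₀ + 2) / γ))
    (hb : b = Real.sqrt d * Real.sqrt (8 * Real.log T / (T * γ))) :
    32 * η / Real.sqrt L + 6 * b + 2 * η ^ 2
      ≤ 1000 * (C₀ + 2) ^ 2 * Real.sqrt (d * Real.log T / (γ * L))
        * (1 + κ * (κ * Real.sqrt (Real.log n / γ) + Real.sqrt (1 / T)) * ρ) := by
  set s := Real.sqrt (d * Real.log T / (γ * L)) with hs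
  have hs0 : 0 ≤ s := Real.sqrt_nonneg _
  have hκ0 : 0 < κ := by linarith
  have hsL : 0 < Real.sqrt L := Real.sqrt_pos.2 hL
  have hρ0 : 0 < ρ := hsL.trans_le hρ
  have hdl : 1 ≤ d * Real.log T := by nlinarith
  have t1 : η / Real.sqrt L ≤ 8 * (C₀ + 2) * s := by
    have e1 : Real.sqrt (4 * (C₀ + 2) / γ) / Real.sqrt L ≤ 2 * (C₀ + 2) * s := by
      rw [← Real.sqrt_div' _ hL.le, hs]
      refine Real.sqrt_le_iff.2 ⟨by positivity, ?_⟩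
      rw [mul_pow, Real.sq_sqrt (by positivity), div_div, mul_div_assoc']
      refine div_le_div_of_nonneg_right ?_ (by positivity)
      have e0 : (2 * (C₀ + 2)) ^ 2 * 1 ≤ (2 * (C₀ + 2)) ^ 2 * (d * Real.log T) :=
        mul_le_mul_of_nonneg_left hdl (sq_nonneg _)
      nlinarith
    rw [hη, mul_div_assoc]
    linarith
  have t2 : b ≤ 3 * (C₀ + 2) * s := by
    rw [hb, ← Real.sqrt_mul (by linarith), hs]
    refine Real.sqrt_le_iff.2 ⟨by positivity, ?_⟩
    rw [mul_pow, Real.sq_sqrt (by positivity), mul_div_assoc', mul_div_assoc',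
      div_le_div_iff₀ (by positivity) (by positivity)]
    -- Trades the 1/T of the projected noise for the 1/L of the target rate.
    have e1 : L ≤ C₀ * T := hLn.trans hnT
    have e2 : 8 * L ≤ (3 * (C₀ + 2)) ^ 2 * T := by nlinarith
    have e3 : 0 ≤ d * Real.log T * γ := by positivity
    nlinarith [mul_le_mul_of_nonneg_left e2 e3]
  -- A lower bound on log n is what lets the bracket absorb 1/γ; it fails at n = 1.
  have hlogn : 1 / 4 ≤ Real.log n := by
    have := Real.log_le_log two_pos hn
    linarith [Real.log_two_gt_d9]
  have t3 : η ^ 2 ≤ 128 * (C₀ + 2) * (s * (κ * (κ * Real.sqrt (Real.log n / γ)) * ρ)) := by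
    have e1 : η ^ 2 = 64 * (C₀ + 2) / γ := by
      rw [hη, mul_pow, Real.sq_sqrt (by positivity)]; ring
    -- The √L cancels the L inside s, leaving √(d log T · log n)/γ ≥ 1/(2γ).
    have e2 : 1 / 2 / γ ≤ s * Real.sqrt (Real.log n / γ) * Real.sqrt L := by
      rw [hs, ← Real.sqrt_mul (by positivity), ← Real.sqrt_mul (by positivity)]
      refine Real.le_sqrt_of_sq_le ?_
      have e3 : d * Real.log T / (γ * L) * (Real.log n / γ) * L
          = d * Real.log T * Real.log n / γ ^ 2 := by field_simp
      rw [e3, div_pow]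
      gcongr
      nlinarith
    have e4 : s * Real.sqrt (Real.log n / γ) * Real.sqrt L
        ≤ s * (κ * (κ * Real.sqrt (Real.log n / γ)) * ρ) := by
      have e5 : (1 : ℝ) ≤ κ * κ := by nlinarith
      have e6 : Real.sqrt (Real.log n / γ) * Real.sqrt L
          ≤ (κ * κ) * Real.sqrt (Real.log n / γ) * ρ := by
        refine mul_le_mul ?_ hρ hsL.le (by positivity)
        exact le_mul_of_one_le_left (Real.sqrt_nonneg _) e5
      calc _ = s * (Real.sqrt (Real.log n / γ) * Real.sqrt L) := by ring
        _ ≤ s * ((κ * κ) * Real.sqrt (Real.log n / γ) * ρ) := mul_le_mul_of_nonneg_left e6 hs0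
        _ = _ := by ring
    have e7 := mul_le_mul_of_nonneg_left (e2.trans e4) (by linarith : 0 ≤ 128 * (C₀ + 2))
    rw [e1]
    refine le_trans (le_of_eq ?_) e7
    ring
  set p := s * (κ * (κ * Real.sqrt (Real.log n / γ)) * ρ) with hp
  have hp0 : 0 ≤ p := by positivity
  have hq0 : 0 ≤ s * (κ * Real.sqrt (1 / T) * ρ) := by positivity
  have e8 : 1000 * (C₀ + 2) ^ 2 * s
      * (1 + κ * (κ * Real.sqrt (Real.log n / γ) + Real.sqrt (1 / T)) * ρ)
      = 1000 * (C₀ + 2) ^ 2 * (s + p + s * (κ * Real.sqrt (1 / T) * ρ)) := by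
    rw [hp]; ring
  rw [e8]
  have e9 : C₀ + 2 ≤ (C₀ + 2) ^ 2 := by nlinarith
  have e10 : 1000 * (C₀ + 2) * (s + p)
      ≤ 1000 * (C₀ + 2) ^ 2 * (s + p + s * (κ * Real.sqrt (1 / T) * ρ)) := by
    refine mul_le_mul (by linarith) (by linarith) (by positivity) (by positivity)
  have e11 : 0 ≤ (C₀ + 2) * s := by positivity
  have e12 : 0 ≤ (C₀ + 2) * p := by positivity
  rw [mul_div_assoc]
  nlinarith

theorem five_pow_mul_exp_le {C₀ : ℝ} {n T : ℕ} (hT : 0 < T) (hn : (n : ℝ) ≤ C₀ * T) :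
    5 ^ n * 5 ^ T * Real.exp (-(2 * (C₀ + 2) * T)) ≤ 1 / (T : ℝ) ^ 2 := by
  have hT' : (0 : ℝ) < T := by positivity
  have h5 : (5 : ℝ) ≤ Real.exp 2 := by
    have h1 := Real.exp_one_gt_d9
    have h2 : Real.exp 2 = Real.exp 1 * Real.exp 1 := by rw [← Real.exp_add]; norm_num
    nlinarith
  have hp : ∀ k : ℕ, (5 : ℝ) ^ k ≤ Real.exp (2 * k) := fun k => by
    rw [mul_comm, Real.exp_nat_mul]
    exact pow_le_pow_left₀ (by norm_num) h5 k
  have hTe : (T : ℝ) ≤ Real.exp T := by linarith [Real.add_one_le_exp (T : ℝ)]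
  calc 5 ^ n * 5 ^ T * Real.exp (-(2 * (C₀ + 2) * T))
      ≤ Real.exp (2 * n) * Real.exp (2 * T) * Real.exp (-(2 * (C₀ + 2) * T)) := by
        gcongr
        · exact hp n
        · exact hp T
    _ = Real.exp (2 * n + 2 * T - 2 * (C₀ + 2) * T) := by
        rw [← Real.exp_add, ← Real.exp_add]; ring_nf
    _ ≤ Real.exp (-(T + T)) := Real.exp_le_exp.2 (by nlinarith)
    _ = 1 / (Real.exp T * Real.exp T) := by rw [Real.exp_neg, Real.exp_add, one_div]
    _ ≤ 1 / (T : ℝ) ^ 2 := by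
        rw [sq]
        gcongr

theorem exp_neg_four_log_le {C₀ : ℝ} {n d T : ℕ} (hC₀ : 0 ≤ C₀) (hT : 0 < T)
    (hn : (n : ℝ) ≤ C₀ * T) (hd : d ≤ n) :
    2 * (n * d) * Real.exp (-(4 * Real.log T)) ≤ 2 * C₀ ^ 2 / (T : ℝ) ^ 2 := by
  have hT' : (0 : ℝ) < T := by positivity
  have h1 : Real.exp (-(4 * Real.log T)) = 1 / (T : ℝ) ^ 4 := by
    rw [Real.exp_neg, mul_comm, Real.exp_mul, Real.exp_log hT', one_div]
    norm_cast
  have h2 : (n * d : ℝ) ≤ (C₀ * T) * (C₀ * T) := by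
    have : (d : ℝ) ≤ n := by exact_mod_cast hd
    exact mul_le_mul hn (this.trans hn) (Nat.cast_nonneg _) (by positivity)
  rw [h1]
  calc 2 * (n * d : ℝ) * (1 / (T : ℝ) ^ 4) ≤ 2 * ((C₀ * T) * (C₀ * T)) * (1 / (T : ℝ) ^ 4) := by
        gcongr
    _ = _ := by field_simp

end Bounds

/-! ### Assembly at one index and along the sequence. -/

section Main

open scoped Matrix.Norms.L2Operator

theorem snr_le {n T : ℕ} (Z : Matrix (Fin n) (Fin T) ℝ) (ν : Fin n → ℝ≥0) (i : Fin n) :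
    snr Z ν ≤ sampleVar (Z i) / ν i :=
  ciInf_le (f := fun i => sampleVar (Z i) / (ν i : ℝ)) (Set.finite_range _).bddBelow i

theorem snr_pos {n T : ℕ} (hn : 0 < n) {Z : Matrix (Fin n) (Fin T) ℝ} {ν : Fin n → ℝ≥0}
    (hZ : ∀ i, 0 < sampleVar (Z i)) (hν : ∀ i, 0 < ν i) : 0 < snr Z ν := by
  have : Nonempty (Fin n) := ⟨⟨0, hn⟩⟩
  obtain ⟨i, hi⟩ := exists_eq_ciInf_of_finite (f := fun i => sampleVar (Z i) / (ν i : ℝ))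
  rw [snr, ← hi]
  exact div_pos (hZ i) (NNReal.coe_pos.2 (hν i))

/-- The error bound at a single index of the sequence. -/
theorem measure_error_compl_le {C₀ c₀ : ℝ} (hC₀ : 1 ≤ C₀) (hc₀ : 0 < c₀) {n T d : ℕ} (hd : 0 < d)
    {Ω : Type*} [MeasurableSpace Ω] {μ : Measure Ω} [IsProbabilityMeasure μ]
    {Zstar : Matrix (Fin n) (Fin T) ℝ} {N : Ω → Matrix (Fin n) (Fin T) ℝ} {ν : Fin n → ℝ≥0}
    {U : Matrix (Fin n) (Fin d) ℝ} {lam : Fin d → ℝ} (hT : 3 ≤ T)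
    (hZ : ∀ i, 0 < sampleVar (Zstar i)) (hν : ∀ i, 0 < ν i)
    (h : IsReducedSpectral (corrMatrix Zstar) U lam) (hN : IsSubgaussianNoise μ N ν)
    (hn : (n : ℝ) ≤ C₀ * T) (hL : c₀ ≤ lastEig hd lam)
    (hγ : 65536 * (C₀ + 2) * (1 / c₀ + 1) ≤ snr Zstar ν) :
    μ {ω | ∀ Xhat : Matrix (Fin n) (Fin d) ℝ,
        IsASE (corrMatrix (Zstar + N ω)) Xhat →
        ∃ Q ∈ Matrix.orthogonalGroup (Fin d) ℝ,
          twoInfNorm (Xhat - embedding U lam * Q) ≤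
            1000 * (C₀ + 2) ^ 2 * Real.sqrt (d * Real.log T / (snr Zstar ν * lastEig hd lam))
              * (1 + condNumber hd lam
                  * (condNumber hd lam * Real.sqrt (Real.log n / snr Zstar ν)
                    + Real.sqrt (1 / (T : ℝ)))
                  * twoInfNorm (corrMatrix Zstar))}ᶜ
      ≤ ENNReal.ofReal (1000 * (C₀ + 2) ^ 2 / (T : ℝ) ^ 2) := by
  have hT0 : 0 < T := by omega
  have hT' : (0 : ℝ) < T := by positivity
  have hn0 : 0 < n := h.size_pos hd
  have hdn : d ≤ n := by
    have h1 := congrArg Matrix.rank h.orthonormal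
    rw [Matrix.rank_one, Fintype.card_fin] at h1
    have h2 := (Matrix.rank_mul_le_right Uᵀ U).trans (Matrix.rank_le_height U)
    omega
  have hγ0 : 0 < snr Zstar ν := snr_pos hn0 hZ hν
  set γ := snr Zstar ν with hγdef
  set L := lastEig hd lam with hLdef
  have hL0 : 0 < L := h.pos _
  have hlogT : 1 ≤ Real.log T := by
    rw [Real.le_log_iff_exp_le hT']
    have : (3 : ℝ) ≤ T := by exact_mod_cast hT
    linarith [Real.exp_one_lt_d9]
  set a := unitScale Zstar with ha
  have hapos := unitScale_pos hT0 hZ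
  set X := scaledRows a Zstar with hX
  have hXi := l2norm_scaledRows_unitScale hT0 hZ
  have hdiag := corrMatrix_diag hT0 hZ
  have hXX : IsReducedSpectral (X * Xᵀ) U lam := by rwa [corrMatrix_eq_gram hT0 hZ] at h
  obtain ⟨V, hV, hXV, hXVV⟩ := exists_right_frame hXX
  let g : ℝ≥0 := Real.toNNReal (1 / (T * γ))
  have hg : (g : ℝ) = 1 / (T * γ) := Real.coe_toNNReal _ (by positivity)
  have hag : ∀ i, a i ^ 2 * (ν i : ℝ) ≤ g := fun i => by
    have h1 := snr_le Zstar ν i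
    have h2 : (0 : ℝ) < ν i := NNReal.coe_pos.2 (hν i)
    have h3 := hZ i
    rw [← hγdef, le_div_iff₀ h2] at h1
    rw [hg, ha, unitScale_sq hZ, inv_mul_eq_div, div_le_div_iff₀ (by positivity) (by positivity)]
    nlinarith
  -- t²/(2g) = 2(C₀ + 2)T beats the net size 5^(n+T) ≤ exp(2(C₀ + 1)T), with exp(−2T) ≤ T⁻² to
  -- spare.
  set t := Real.sqrt (4 * (C₀ + 2) / γ) with ht
  -- b²/(2g) = 4 log T: the tail T⁻⁴ outweighs the 2nd ≤ 2C₀²T² events of the union bound.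
  set b := Real.sqrt (8 * Real.log T / (T * γ)) with hb
  -- The failure set is enclosed in two explicit noise events, so measurability of the success event
  -- never enters.
  have hsub : {ω | ∀ Xhat : Matrix (Fin n) (Fin d) ℝ,
        IsASE (corrMatrix (Zstar + N ω)) Xhat →
        ∃ Q ∈ Matrix.orthogonalGroup (Fin d) ℝ,
          twoInfNorm (Xhat - embedding U lam * Q) ≤
            1000 * (C₀ + 2) ^ 2 * Real.sqrt (d * Real.log T / (γ * L))
              * (1 + condNumber hd lam
                  * (condNumber hd lam * Real.sqrt (Real.log n / γ)
                    + Real.sqrt (1 / (T : ℝ)))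
                  * twoInfNorm (corrMatrix Zstar))}ᶜ
      ⊆ {ω | ¬ ‖scaledRows a (N ω)‖ ≤ 4 * t}
        ∪ {ω | ¬ ∀ i, l2norm ((scaledRows a (N ω) * V) i) ≤ Real.sqrt d * b} := by
    intro ω hω
    by_contra hcon
    rw [Set.mem_union, not_or] at hcon
    have hE : ‖scaledRows a (N ω)‖ ≤ 4 * t := not_not.1 hcon.1
    have hEV : ∀ i, l2norm ((scaledRows a (N ω) * V) i) ≤ Real.sqrt d * b := not_not.1 hcon.2
    refine hω fun Xhat hXhat => ?_
    have hc₀' : 0 < 1 / c₀ := by positivity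
    have ht2 : t ^ 2 = 4 * (C₀ + 2) / γ := Real.sq_sqrt (by positivity)
    have ht0 : 0 ≤ t := Real.sqrt_nonneg _
    have hη : 4 * t ≤ 1 / 2 := by
      refine abs_le_of_sq_le_sq' ?_ (by norm_num) |>.2
      rw [mul_pow, ht2, mul_div_assoc', div_le_iff₀ hγ0]
      nlinarith
    -- (32 · 4)² · 4 = 65536 is the constant in `hγ`; its 1/c₀ part serves here, and the + 1 part
    -- serves `hη`.
    have hηL : 32 * (4 * t) ≤ Real.sqrt L := by
      refine Real.le_sqrt_of_sq_le (le_trans ?_ hL)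
      rw [mul_pow, mul_pow, ht2, mul_div_assoc', mul_div_assoc', div_le_iff₀ hγ0]
      have e1 := mul_le_mul_of_nonneg_left hγ hc₀.le
      have e2 : c₀ * (65536 * (C₀ + 2) * (1 / c₀ + 1))
          = 65536 * (C₀ + 2) + c₀ * (65536 * (C₀ + 2)) := by field_simp
      have e3 : 0 ≤ c₀ * (65536 * (C₀ + 2)) := by positivity
      rw [e2] at e1
      linarith
    have hR : corrMatrix (Zstar + N ω) = Matrix.of fun i j =>
        ((X + scaledRows a (N ω)) * (X + scaledRows a (N ω))ᵀ) i j
          / (l2norm ((X + scaledRows a (N ω)) i) * l2norm ((X + scaledRows a (N ω)) j)) := by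
      rw [corrMatrix_eq_normalized_gram hT0 hapos, scaledRows_add]
    rw [hR] at hXhat
    -- For n = 1 log n vanishes and the rate comparison is unavailable, but both correlation
    -- matrices are then the scalar 1 and the error is zero.
    rcases Nat.lt_or_ge n 2 with hn2 | hn2
    · obtain rfl : n = 1 := by omega
      have h1 : (Matrix.of fun i j =>
        ((X + scaledRows a (N ω)) * (X + scaledRows a (N ω))ᵀ) i j
          / (l2norm ((X + scaledRows a (N ω)) i) * l2norm ((X + scaledRows a (N ω)) j)) :
          Matrix (Fin 1) (Fin 1) ℝ) 0 0 = 1 := by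
        have e1 : ((X + scaledRows a (N ω)) * (X + scaledRows a (N ω))ᵀ) 0 0
            = l2norm ((X + scaledRows a (N ω)) 0) ^ 2 := (l2norm_sq_eq_dotProduct _).symm
        have e2 : 1 / 2 ≤ l2norm ((X + scaledRows a (N ω)) 0) :=
          half_le_l2norm_add (hXi 0) ((l2norm_row_le_opNorm _ _).trans (hE.trans hη))
        rw [Matrix.of_apply, e1, sq]
        exact div_self (by positivity)
      obtain ⟨Q, hQ, hQ0⟩ := exists_rotation_eq_of_size_one hd h (hdiag 0) h1 hXhat
      refine ⟨Q, hQ, ?_⟩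
      have e3 : twoInfNorm (0 : Matrix (Fin 1) (Fin d) ℝ) ≤ 0 :=
        twoInfNorm_le le_rfl fun i => by simp [l2norm]
      have e4 : 0 ≤ twoInfNorm (corrMatrix Zstar) :=
        (l2norm_nonneg _).trans (l2norm_row_le_twoInfNorm _ 0)
      have e5 := h.one_le_condNumber hd
      rw [hQ0]
      refine e3.trans ?_
      positivity
    · obtain ⟨Q, hQ, hrow⟩ := exists_rotation_row_error_le hd hXi hXX hV hXV hXVV hE hη hηL hEV
        hXhat
      have hrate := error_le_rate (d := d) (n := n) hC₀ hT' hlogT (by exact_mod_cast hn2) hn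
        (by exact_mod_cast hd) hγ0 hL0 (h.lastEig_le_size hd hdiag) (h.one_le_condNumber hd)
        (h.sqrt_lastEig_le_twoInfNorm hd hdiag) rfl rfl
      refine ⟨Q, hQ, twoInfNorm_le ?_ fun i => (hrow i).trans hrate⟩
      exact (l2norm_nonneg _).trans ((hrow ⟨0, hn0⟩).trans hrate)
  have hp1 : μ.real {ω | ¬ ‖scaledRows a (N ω)‖ ≤ 4 * t} ≤ 1 / (T : ℝ) ^ 2 := by
    refine (hN.opNorm_tail hag (Real.sqrt_nonneg _)).trans ?_
    have e1 : -t ^ 2 / (2 * (g : ℝ)) = -(2 * (C₀ + 2) * T) := by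
      rw [hg, ht, Real.sq_sqrt (by positivity)]
      field_simp
      ring
    rw [e1]
    exact five_pow_mul_exp_le hT0 hn
  have hp2 : μ.real {ω | ¬ ∀ i, l2norm ((scaledRows a (N ω) * V) i) ≤ Real.sqrt d * b}
      ≤ 2 * C₀ ^ 2 / (T : ℝ) ^ 2 := by
    refine (hN.projected_rows_tail hag hV (Real.sqrt_nonneg _)).trans ?_
    have e1 : -b ^ 2 / (2 * (g : ℝ)) = -(4 * Real.log T) := by
      rw [hg, hb, Real.sq_sqrt (by positivity)]
      field_simp
      ring
    rw [e1]
    exact exp_neg_four_log_le (by linarith) hT0 hn hdn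
  refine (measure_mono hsub).trans ?_
  rw [← ofReal_measureReal]
  refine ENNReal.ofReal_le_ofReal ((measureReal_union_le _ _).trans ?_)
  refine (add_le_add hp1 hp2).trans ?_
  rw [← add_div]
  gcongr
  nlinarith

end Main

end CorrNet

theorem theorem1 (C₀ c₀ : ℝ) (hc₀ : 0 < c₀) :
    ∃ C : ℝ, 0 < C ∧
      ∀ (n T d : ℕ → ℕ) (hd : ∀ m, 0 < d m)
        (Ω : ℕ → Type*) [∀ m, MeasurableSpace (Ω m)]
        (μ : ∀ m, Measure (Ω m)) [∀ m, IsProbabilityMeasure (μ m)]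
        (Zstar : ∀ m, Matrix (Fin (n m)) (Fin (T m)) ℝ)
        (N : ∀ m, Ω m → Matrix (Fin (n m)) (Fin (T m)) ℝ)
        (ν : ∀ m, Fin (n m) → ℝ≥0)
        (Ustar : ∀ m, Matrix (Fin (n m)) (Fin (d m)) ℝ)
        (lam : ∀ m, Fin (d m) → ℝ),
        -- the asymptotic regime
        Tendsto T atTop atTop →
        -- non-degenerate signals and positive subgaussian parameters
        (∀ m i, 0 < CorrNet.sampleVar (Zstar m i)) →
        (∀ m i, 0 < ν m i) →
        -- spectral decomposition of the true correlation matrix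
        (∀ m, CorrNet.IsReducedSpectral (CorrNet.corrMatrix (Zstar m)) (Ustar m) (lam m)) →
        -- assumptions on the noise
        (∀ m, CorrNet.IsSubgaussianNoise (μ m) (N m) (ν m)) →
        (∀ᶠ m in atTop, (n m : ℝ) ≤ C₀ * (T m : ℝ)) →
        -- assumptions on the spectrum
        (∀ᶠ m in atTop, c₀ ≤ CorrNet.lastEig (hd m) (lam m)) →
        ((fun m => CorrNet.condNumber (hd m) (lam m)) =o[atTop] fun m => (T m : ℝ)) →
        Tendsto (fun m => CorrNet.condNumber (hd m) (lam m) * Real.log (T m)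
          / CorrNet.snr (Zstar m) (ν m)) atTop (𝓝 0) →
        -- the error bound
        ∀ᶠ m in atTop,
          μ m {ω | ∀ Xhat : Matrix (Fin (n m)) (Fin (d m)) ℝ,
              CorrNet.IsASE (CorrNet.corrMatrix (Zstar m + N m ω)) Xhat →
              ∃ Q ∈ Matrix.orthogonalGroup (Fin (d m)) ℝ,
                CorrNet.twoInfNorm (Xhat - CorrNet.embedding (Ustar m) (lam m) * Q) ≤
                  C * Real.sqrt (d m * Real.log (T m)
                      / (CorrNet.snr (Zstar m) (ν m) * CorrNet.lastEig (hd m) (lam m)))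
                    * (1 + CorrNet.condNumber (hd m) (lam m)
                        * (CorrNet.condNumber (hd m) (lam m)
                            * Real.sqrt (Real.log (n m) / CorrNet.snr (Zstar m) (ν m))
                          + Real.sqrt (1 / (T m : ℝ)))
                        * CorrNet.twoInfNorm (CorrNet.corrMatrix (Zstar m)))}ᶜ
            ≤ ENNReal.ofReal (C / (T m : ℝ) ^ 2) := by

  -- C₀ is an arbitrary real; enlarging it to at least 1 keeps n ≤ C₀T valid.
  have hC₀ : 1 ≤ max C₀ 1 := le_max_right _ _
  refine ⟨1000 * (max C₀ 1 + 2) ^ 2, by positivity, ?_⟩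
  intro n T d hd Ω _ μ _ Zstar N ν Ustar lam hT hZ hν hspec hN hn hL _ hsnr
  set A : ℝ := 65536 * (max C₀ 1 + 2) * (1 / c₀ + 1) with hA
  have hApos : 0 < A := by positivity
  filter_upwards [hn, hL, hT.eventually_ge_atTop 3,
    hsnr.eventually_lt_const (inv_pos.2 hApos)] with m hnm hLm hTm hsnrm
  have hγ := CorrNet.snr_pos ((hspec m).size_pos (hd m)) (hZ m) (hν m)
  have hκ := (hspec m).one_le_condNumber (hd m)
  have hT3 : (3 : ℝ) ≤ T m := by exact_mod_cast hTm
  have hlogT : 1 ≤ Real.log (T m) := by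
    rw [Real.le_log_iff_exp_le (by linarith)]
    linarith [Real.exp_one_lt_d9]
  refine CorrNet.measure_error_compl_le hC₀ hc₀ (hd m) hTm (hZ m) (hν m) (hspec m) (hN m) ?_ hLm ?_
  · exact hnm.trans (mul_le_mul_of_nonneg_right (le_max_left _ _) (Nat.cast_nonneg _))
  -- Since κ log T ≥ 1, the bound κ log T/γ < 1/A forces γ > A.
  · rw [div_lt_iff₀ hγ, inv_mul_eq_div, lt_div_iff₀ hApos] at hsnrm
    have : 1 ≤ CorrNet.condNumber (hd m) (lam m) * Real.log (T m) := by nlinarith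
    nlinarith
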